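/- Let $0<p<1$ be fixed and $q=1-p$. For $n\ge 2$, edge flipping on the complete graph $K_n$ is the Markov chain on the set $\Omega_n$ of all $2^n$ colourings of the vertices of $K_n$ with blue and red in which, at each step, one of the $\binom n2$ edges is chosen uniformly at random and, independently, both of its endpoints are coloured blue with probability $p$ or red with probability $q$. This chain has a unique stationary distribution $\pi_n$. Let $$d_n(k)=\max_{z\in\Omega_n}\ \tfrac12\sum_{x\in\Omega_n}\bigl|P_z^k(x)-\pi_n(x)\bigr|,$$ where $P_z^k$ is the law of the chain after $k$ steps from the initial colouring $z$. For real $s$ put $d_n(s)=d_n(\max(\lfloor s\rfloor,0))$. Then edge flipping on $K_n$ exhibits a cutoff at time $t_n=\frac14 n\log n$ with a window of order $n$; that is, with $w_n=n$, $$\lim_{n\to\infty}\frac{w_n}{t_n}=0,\qquad \lim_{\gamma\to-\infty}\liminf_{n\to\infty}d_n(t_n+\gamma w_n)=1,\qquad \lim_{\gamma\to\infty}\limsup_{n\to\infty}d_n(t_n+\gamma w_n)=0.$$ -/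

import Mathlib

open Filter Topology

noncomputable section

/-- A colour configuration of the vertices `V`: `true` is blue and `false` is red. -/
abbrev ColorConfig (V : Type*) : Type _ := V → Bool

/-- The configuration obtained from `C` by giving both endpoints of `e` the colour `b`. -/
def paintEdge {V : Type*} [DecidableEq V] (e : Sym2 V) (b : Bool) (C : ColorConfig V) :
    ColorConfig V :=
  fun v => if v ∈ e then b else C v

/-- The transition matrix of edge flipping on the graph `G`: at each step one of the `m` edges is
chosen uniformly at random, and both of its endpoints are coloured blue with probability `p` or red
with probability `1 - p`. The entry at `(C, C')` is the probability of moving from `C` to `C'`. -/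
def edgeFlipping {V : Type*} [Fintype V] [DecidableEq V] (G : SimpleGraph V) [DecidableRel G.Adj]
    (p : ℝ) : Matrix (ColorConfig V) (ColorConfig V) ℝ :=
  fun C C' => ∑ e ∈ G.edgeFinset,
    (p / (G.edgeFinset.card : ℝ) * (if paintEdge e true C = C' then 1 else 0) +
      (1 - p) / (G.edgeFinset.card : ℝ) * (if paintEdge e false C = C' then 1 else 0))

/-- `π` is a probability distribution on the finite set `Ω` that is stationary for the transition
matrix `P`. -/
def IsStationaryDistribution {Ω : Type*} [Fintype Ω] (P : Matrix Ω Ω ℝ) (π : Ω → ℝ) : Prop :=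
  (∀ x, 0 ≤ π x) ∧ ∑ x, π x = 1 ∧ ∀ y, ∑ x, π x * P x y = π y

/-- The total variation distance between two distributions on a finite set. -/
def totalVariation {Ω : Type*} [Fintype Ω] (μ ν : Ω → ℝ) : ℝ :=
  1 / 2 * ∑ x, |μ x - ν x|

/-- The maximum over all initial states `z` of the total variation distance between `π` and the law
`(P ^ t) z` after `t` steps of the chain with transition matrix `P` started at `z`. -/
def distToStationary {Ω : Type*} [Fintype Ω] [DecidableEq Ω] (P : Matrix Ω Ω ℝ) (π : Ω → ℝ)
    (t : ℕ) : ℝ :=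
  ⨆ z : Ω, totalVariation ((P ^ t) z) π

/-- A sequence of Markov chains, the `n`-th of which is at distance `d n k` from stationarity after
`k` steps, has a cutoff at time `t n` with a window of size `w n`. A real time `s` is read as the
number of steps `⌊s⌋₊`, which is `0` for negative `s`. -/
structure HasCutoff (d : ℕ → ℕ → ℝ) (t w : ℕ → ℝ) : Prop where
  window : Tendsto (fun n => w n / t n) atTop (𝓝 0)
  before : Tendsto (fun γ : ℝ => liminf (fun n => d n ⌊t n + γ * w n⌋₊) atTop) atBot (𝓝 1)
  after : Tendsto (fun γ : ℝ => limsup (fun n => d n ⌊t n + γ * w n⌋₊) atTop) atTop (𝓝 0)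

end

/-! The chain is studied on the complete graph with vertex set `V` and `n` vertices, as the chain
`stepMatrix p paintEdge` driven by a random edge and a random colour.

**Before the cutoff.** The centred number of blue vertices `blueExcess` is an eigenfunction with
eigenvalue `1 - 2 / n`, and its variance stays at most `n`, also under the stationary distribution.
From the all-blue configuration its mean after `n log n / 4 + γ n` steps is of order
`√n * exp (-2 * γ)`, so for very negative `γ` Chebyshev's inequality separates the two laws
(`one_sub_le_distToStationary`).

**After the cutoff.** At that time about `√n * exp (-2 * γ)` vertices have not been touched, and
they remember the initial configuration. They are hidden in the fluctuations of the others. To see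
this, the edges are revealed backwards in time. If an edge is the last one to cover both of its
endpoints, these form a pair of equal colour; if it is the last one for only one endpoint, that
vertex gets an independent colour. The statuses of the vertices form a dual chain
`stepMatrix p revealEdge` that does not depend on the initial configuration (`pow_paintEdge_apply`).
Given the pairs, their colours and the number `u` of untouched vertices, the untouched vertices are
a uniformly random subset of the `N` free (unpaired) ones, because the dual chain is exchangeable.
The law of the colours of the free vertices, relative to the product law, has second moment
`E (K ^ #(U ∩ U')) ≤ exp (K * u ^ 2 / N)` for independent random subsets `U`, `U'` of size `u`
and a constant `K` depending on `p`, so by Cauchy-Schwarz its distance to the product law is of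
order `u / √N` (`sum_abs_sum_configLaw_sub_le`). The mean of `u` is `n * (1 - 2 / n) ^ t`, and
`N ≥ n / 4` with high probability, by a quadratic Lyapunov function for the number of pairs
(`sum_pow_card_freeSet_lt_le`). Hence the laws from all initial configurations are close to the
single law `freshStartLaw`, and so is the stationary one.

Existence and uniqueness of the stationary distribution on a fixed graph come from the same dual
chain: the initial configuration is forgotten once no vertex is untouched, which happens with
probability tending geometrically to `1`. -/

/-! ### Averages over a random edge and a random colour -/

/-- The distribution of a single random colour: blue with probability `p`, red with
probability `1 - p`. -/
def colorProb (p : ℝ) (b : Bool) : ℝ := if b then p else 1 - p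

lemma sum_colorProb (p : ℝ) : ∑ b, colorProb p b = 1 := by simp [colorProb]

lemma colorProb_nonneg {p : ℝ} (h0 : 0 ≤ p) (h1 : p ≤ 1) (b : Bool) : 0 ≤ colorProb p b := by
  cases b <;> simp [colorProb] <;> linarith

/-- The average of `F e b` over a uniformly random edge `e` of the complete graph on `V` and an
independent random colour `b`. The edge is encoded as an ordered pair of distinct endpoints, so
that sums over edges become double sums over vertices. -/
noncomputable def stepMean {V : Type*} [Fintype V] [DecidableEq V] (p : ℝ)
    (F : Sym2 V → Bool → ℝ) : ℝ :=
  (∑ a : V, ∑ c : V, if a = c then 0 else ∑ b, colorProb p b * F s(a, c) b) /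
    ((Fintype.card V : ℝ) * (Fintype.card V - 1))

/-- The transition matrix of the chain that moves from `x` to `f e b x`, for a uniformly random
edge `e` and an independent random colour `b`. -/
noncomputable def stepMatrix {V Ω : Type*} [Fintype V] [DecidableEq V] [DecidableEq Ω] (p : ℝ)
    (f : Sym2 V → Bool → Ω → Ω) : Matrix Ω Ω ℝ :=
  fun x y => stepMean p fun e b => if f e b x = y then 1 else 0

section StepMean

variable {V Ω : Type*} [Fintype V] [DecidableEq V] [Fintype Ω] [DecidableEq Ω] {p : ℝ}

lemma card_mul_card_sub_one_pos {V : Type*} [Fintype V] (hV : 2 ≤ Fintype.card V) :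
    0 < (Fintype.card V : ℝ) * (Fintype.card V - 1) := by
  have : (2 : ℝ) ≤ Fintype.card V := by exact_mod_cast hV
  nlinarith

lemma sum_sum_offDiag (f : V → V → ℝ) :
    ∑ a, ∑ c, (if a = c then 0 else f a c) = ∑ a, ∑ c, f a c - ∑ a, f a a := by
  rw [← Finset.sum_sub_distrib]
  refine Finset.sum_congr rfl fun a _ => ?_
  have : ∀ c, (if a = c then 0 else f a c) = f a c - if a = c then f a c else 0 := by
    intro c; split_ifs <;> simp
  simp [this]

lemma sum_sum_offDiag_const (r : ℝ) :
    ∑ a : V, ∑ c : V, (if a = c then 0 else r) =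
      (Fintype.card V : ℝ) * (Fintype.card V - 1) * r := by
  rw [sum_sum_offDiag fun _ _ => r]
  simp
  ring

lemma stepMean_const (hV : 2 ≤ Fintype.card V) (r : ℝ) :
    stepMean (V := V) p (fun _ _ => r) = r := by
  have h := (card_mul_card_sub_one_pos hV).ne'
  have : ∑ b, colorProb p b * r = r := by rw [← Finset.sum_mul, sum_colorProb, one_mul]
  simp only [stepMean, this]
  rw [sum_sum_offDiag_const, mul_div_cancel_left₀ _ h]

lemma stepMean_add (F G : Sym2 V → Bool → ℝ) :
    stepMean p (fun e b => F e b + G e b) = stepMean p F + stepMean p G := by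
  simp only [stepMean, ← add_div, ← Finset.sum_add_distrib, mul_add]
  congr 1
  refine Finset.sum_congr rfl fun a _ => Finset.sum_congr rfl fun c _ => ?_
  split_ifs
  · simp
  · simp only [Fintype.sum_bool]; ring

lemma stepMean_const_mul (r : ℝ) (F : Sym2 V → Bool → ℝ) :
    stepMean p (fun e b => r * F e b) = r * stepMean p F := by
  simp only [stepMean, ← mul_div_assoc, Finset.mul_sum (Finset.univ : Finset V)]
  congr 1
  refine Finset.sum_congr rfl fun a _ => Finset.sum_congr rfl fun c _ => ?_
  split_ifs
  · simp
  · simp only [Fintype.sum_bool]; ring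

lemma stepMean_sum {ι : Type*} (s : Finset ι) (F : ι → Sym2 V → Bool → ℝ) :
    stepMean p (fun e b => ∑ i ∈ s, F i e b) = ∑ i ∈ s, stepMean p (F i) := by
  classical
  induction s using Finset.induction_on with
  | empty => simp [stepMean]
  | insert i s hi ih => simp only [Finset.sum_insert hi, stepMean_add, ih]

lemma stepMean_mono (h0 : 0 ≤ p) (h1 : p ≤ 1) (hV : 2 ≤ Fintype.card V)
    {F G : Sym2 V → Bool → ℝ} (h : ∀ e b, F e b ≤ G e b) : stepMean p F ≤ stepMean p G := by
  refine div_le_div_of_nonneg_right ?_ (card_mul_card_sub_one_pos hV).le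
  refine Finset.sum_le_sum fun a _ => Finset.sum_le_sum fun c _ => ?_
  split_ifs
  · rfl
  · exact Finset.sum_le_sum fun b _ => mul_le_mul_of_nonneg_left (h _ _) (colorProb_nonneg h0 h1 b)

lemma stepMean_map (σ : Equiv.Perm V) (F : Sym2 V → Bool → ℝ) :
    stepMean p (fun e b => F (e.map σ) b) = stepMean p F := by
  unfold stepMean
  congr 1
  conv_rhs => rw [← Equiv.sum_comp σ]
  refine Finset.sum_congr rfl fun a _ => ?_
  conv_rhs => rw [← Equiv.sum_comp σ]
  simp

/-- Each edge of the complete graph corresponds to two ordered pairs of distinct endpoints. -/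
lemma sum_sum_sym2 (f : Sym2 V → ℝ) :
    ∑ a : V, ∑ c : V, (if a = c then 0 else f s(a, c)) =
      2 * ∑ e ∈ (⊤ : SimpleGraph V).edgeFinset, f e := by
  have h1 : ∑ d : (⊤ : SimpleGraph V).Dart, f d.edge =
      2 * ∑ e ∈ (⊤ : SimpleGraph V).edgeFinset, f e := by
    rw [← Finset.sum_fiberwise_of_maps_to (s := Finset.univ) (t := (⊤ : SimpleGraph V).edgeFinset)
      (g := SimpleGraph.Dart.edge)
      (fun d _ => by rw [SimpleGraph.mem_edgeFinset]; exact d.edge_mem), Finset.mul_sum]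
    refine Finset.sum_congr rfl fun e he => ?_
    rw [Finset.sum_congr rfl (g := fun _ => f e)
      (fun d hd => by rw [(Finset.mem_filter.1 hd).2]), Finset.sum_const,
      SimpleGraph.dart_edge_fiber_card _ e (SimpleGraph.mem_edgeFinset.1 he)]
    simp
  rw [← h1, ← Fintype.sum_prod_type' (f := fun a c => if a = c then 0 else f s(a, c))]
  have h2 : ∀ x : V × V, (if x.1 = x.2 then 0 else f s(x.1, x.2)) =
      if x.1 ≠ x.2 then f s(x.1, x.2) else 0 := fun x => by split_ifs <;> simp_all
  simp only [h2]
  rw [← Finset.sum_filter]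
  refine Finset.sum_bij' (fun x hx => ⟨x, (Finset.mem_filter.1 hx).2⟩) (fun d _ => d.toProd)
    ?_ ?_ ?_ ?_ ?_
  · simp
  · intro d _; simp
  · simp
  · simp
  · intro x hx; rfl

lemma edgeFlipping_top_eq_stepMatrix (p : ℝ) :
    edgeFlipping (⊤ : SimpleGraph V) p = stepMatrix p paintEdge := by
  ext C C'
  unfold edgeFlipping stepMatrix stepMean
  rw [sum_sum_sym2 (fun e => ∑ b, colorProb p b * if paintEdge e b C = C' then (1 : ℝ) else 0)]
  have hc : (2 : ℝ) * (⊤ : SimpleGraph V).edgeFinset.card =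
      (Fintype.card V : ℝ) * (Fintype.card V - 1) := by
    have := sum_sum_sym2 (V := V) (fun _ => (1 : ℝ))
    rw [sum_sum_offDiag_const] at this
    simpa using this.symm
  rw [← hc, mul_div_mul_left _ _ two_ne_zero, Finset.sum_div]
  refine Finset.sum_congr rfl fun e _ => ?_
  simp only [Fintype.sum_bool, colorProb, ↓reduceIte, Bool.false_eq_true]
  ring

lemma sum_stepMatrix_mul (f : Sym2 V → Bool → Ω → Ω) (x : Ω) (g : Ω → ℝ) :
    ∑ y, stepMatrix p f x y * g y = stepMean p fun e b => g (f e b x) := by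
  have : ∀ y, stepMatrix p f x y * g y =
      stepMean p fun e b => g y * if f e b x = y then 1 else 0 := by
    intro y; rw [stepMean_const_mul, mul_comm]; rfl
  simp only [this]
  rw [← stepMean_sum]
  simp

lemma stepMatrix_mem_rowStochastic (h0 : 0 ≤ p) (h1 : p ≤ 1) (hV : 2 ≤ Fintype.card V)
    (f : Sym2 V → Bool → Ω → Ω) : stepMatrix p f ∈ Matrix.rowStochastic ℝ Ω := by
  rw [Matrix.mem_rowStochastic_iff_sum]
  constructor
  · intro x y
    rw [← stepMean_const (V := V) (p := p) hV 0]
    exact stepMean_mono h0 h1 hV fun e b => by split_ifs <;> simp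
  · intro x
    simpa [stepMean_const hV] using sum_stepMatrix_mul (p := p) f x (fun _ => 1)

lemma sum_pow_succ_stepMatrix_mul (f : Sym2 V → Bool → Ω → Ω) (x : Ω) (g : Ω → ℝ) (t : ℕ) :
    ∑ y, (stepMatrix p f ^ (t + 1)) x y * g y =
      ∑ y, (stepMatrix p f ^ t) x y * stepMean p fun e b => g (f e b y) := by
  simp only [pow_succ, Matrix.mul_apply, Finset.sum_mul, ← sum_stepMatrix_mul, Finset.mul_sum]
  rw [Finset.sum_comm]
  simp only [mul_assoc]

/-- The average of a step functional that is a polynomial in the indicators of the endpoints of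
the edge depends only on the size `∑ v, x v` of the indicated set. -/
lemma stepMean_eq_of_indicator (hV : 2 ≤ Fintype.card V) {F : Sym2 V → Bool → ℝ} (x : V → ℝ)
    (hx : ∀ v, x v * x v = x v) (A B D : ℝ)
    (h : ∀ a c, a ≠ c →
      ∑ b, colorProb p b * F s(a, c) b = A + B * (x a + x c) + D * (x a * x c)) :
    stepMean p F = A + 2 * B * (∑ v, x v) / Fintype.card V +
      D * ((∑ v, x v) * (∑ v, x v - 1)) / ((Fintype.card V : ℝ) * (Fintype.card V - 1)) := by
  have hn : (2 : ℝ) ≤ Fintype.card V := by exact_mod_cast hV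
  have h1 : ∑ a : V, ∑ c : V, (if a = c then 0 else ∑ b, colorProb p b * F s(a, c) b) =
      ∑ a : V, ∑ c : V, (if a = c then 0 else A + B * (x a + x c) + D * (x a * x c)) :=
    Finset.sum_congr rfl fun a _ => Finset.sum_congr rfl fun c _ => by
      split_ifs with hac
      · rfl
      · exact h a c hac
  unfold stepMean
  rw [h1, sum_sum_offDiag fun a c => A + B * (x a + x c) + D * (x a * x c)]
  simp only [hx, Finset.sum_add_distrib, ← Finset.mul_sum, ← Finset.sum_mul,
    Finset.sum_const, Finset.card_univ, nsmul_eq_mul]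
  have h3 : (Fintype.card V : ℝ) ≠ 0 := by linarith
  have h4 : (Fintype.card V : ℝ) - 1 ≠ 0 := by linarith
  field_simp
  ring

end StepMean

/-! ### Laws of finite chains -/

section Chain

variable {Ω : Type*} [Fintype Ω] [DecidableEq Ω]

lemma sum_abs_le_two {Ω : Type*} [Fintype Ω] {μ ν : Ω → ℝ} (hμ : ∀ x, 0 ≤ μ x) (hμ1 : ∑ x, μ x = 1)
    (hν : ∀ x, 0 ≤ ν x) (hν1 : ∑ x, ν x = 1) : ∑ x, |μ x - ν x| ≤ 2 := by
  calc ∑ x, |μ x - ν x| ≤ ∑ x, (μ x + ν x) := Finset.sum_le_sum fun x _ => by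
        rw [abs_le]; constructor <;> linarith [hμ x, hν x]
    _ = 2 := by rw [Finset.sum_add_distrib, hμ1, hν1]; norm_num

lemma IsStationaryDistribution.sum_mul_pow {P : Matrix Ω Ω ℝ} {π : Ω → ℝ}
    (h : IsStationaryDistribution P π) (t : ℕ) (y : Ω) : ∑ x, π x * (P ^ t) x y = π y := by
  induction t generalizing y with
  | zero => simp [Matrix.one_apply]
  | succ t ih =>
    simp only [pow_succ, Matrix.mul_apply, Finset.mul_sum]
    rw [Finset.sum_comm]
    simp only [← mul_assoc, ← Finset.sum_mul, ih]
    exact h.2.2 y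

/-- If every row of `P ^ t` is within `B` of `ν`, then so is every stationary distribution. -/
lemma IsStationaryDistribution.sum_abs_sub_le {P : Matrix Ω Ω ℝ} {π ν : Ω → ℝ}
    (h : IsStationaryDistribution P π) {t : ℕ} {B : ℝ}
    (hB : ∀ z, ∑ x, |(P ^ t) z x - ν x| ≤ B) : ∑ x, |π x - ν x| ≤ B := by
  have key : ∀ x, π x - ν x = ∑ z, π z * ((P ^ t) z x - ν x) := by
    intro x
    simp only [mul_sub, Finset.sum_sub_distrib, h.sum_mul_pow, ← Finset.sum_mul, h.2.1, one_mul]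
  calc ∑ x, |π x - ν x| ≤ ∑ x, ∑ z, π z * |(P ^ t) z x - ν x| := by
        refine Finset.sum_le_sum fun x _ => ?_
        rw [key]
        refine (Finset.abs_sum_le_sum_abs _ _).trans (le_of_eq ?_)
        exact Finset.sum_congr rfl fun z _ => by rw [abs_mul, abs_of_nonneg (h.1 z)]
    _ = ∑ z, π z * ∑ x, |(P ^ t) z x - ν x| := by
        rw [Finset.sum_comm]; simp only [Finset.mul_sum]
    _ ≤ ∑ z, π z * B := Finset.sum_le_sum fun z _ => mul_le_mul_of_nonneg_left (hB z) (h.1 z)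
    _ = B := by rw [← Finset.sum_mul, h.2.1, one_mul]

lemma totalVariation_le_distToStationary (P : Matrix Ω Ω ℝ) (π : Ω → ℝ) (t : ℕ) (z : Ω) :
    totalVariation ((P ^ t) z) π ≤ distToStationary P π t :=
  le_ciSup (f := fun z => totalVariation ((P ^ t) z) π) (Set.finite_range _).bddAbove z

lemma distToStationary_nonneg [Nonempty Ω] (P : Matrix Ω Ω ℝ) (π : Ω → ℝ) (t : ℕ) :
    0 ≤ distToStationary P π t := by
  refine le_trans ?_ (totalVariation_le_distToStationary P π t (Classical.arbitrary Ω))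
  unfold totalVariation
  positivity

lemma distToStationary_le_one [Nonempty Ω] {P : Matrix Ω Ω ℝ} {π : Ω → ℝ}
    (hP : P ∈ Matrix.rowStochastic ℝ Ω) (h : IsStationaryDistribution P π) (t : ℕ) :
    distToStationary P π t ≤ 1 := by
  refine ciSup_le fun z => ?_
  have hPt := pow_mem hP t
  have := sum_abs_le_two (fun x => Matrix.nonneg_of_mem_rowStochastic hPt (i := z) (j := x))
    (Matrix.sum_row_of_mem_rowStochastic hPt z) h.1 h.2.1
  unfold totalVariation
  linarith

lemma distToStationary_le [Nonempty Ω] {P : Matrix Ω Ω ℝ} {π ν : Ω → ℝ}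
    (h : IsStationaryDistribution P π) {t : ℕ} {B : ℝ}
    (hB : ∀ z, ∑ x, |(P ^ t) z x - ν x| ≤ B) : distToStationary P π t ≤ B := by
  refine ciSup_le fun z => ?_
  have h2 := h.sum_abs_sub_le hB
  have h3 : ∑ x, |(P ^ t) z x - π x| ≤ ∑ x, |(P ^ t) z x - ν x| + ∑ x, |π x - ν x| := by
    rw [← Finset.sum_add_distrib]
    refine Finset.sum_le_sum fun x _ => ?_
    rw [abs_sub_comm (π x)]
    exact abs_sub_le _ _ _
  unfold totalVariation
  linarith [hB z]

end Chain

/-! ### The number of blue vertices and the lower bound -/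

section Blue

variable {V : Type*} [Fintype V] [DecidableEq V] {p : ℝ}

/-- The number of blue vertices, centred at its stationary mean `p * |V|`. -/
def blueExcess (p : ℝ) (C : ColorConfig V) : ℝ :=
  ∑ v, (if C v then (1 : ℝ) else 0) - Fintype.card V * p

lemma blueExcess_paintEdge (C : ColorConfig V) {a c : V} (hac : a ≠ c) (b : Bool) :
    blueExcess p (paintEdge s(a, c) b C) = blueExcess p C -
      ((if C a then 1 else 0) + (if C c then 1 else 0)) + (if b then 2 else 0) := by
  have key : ∀ f : V → ℝ, ∑ v, f v = f a + f c + ∑ v ∈ (Finset.univ.erase a).erase c, f v := by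
    intro f
    rw [← Finset.add_sum_erase _ f (Finset.mem_univ a), add_assoc,
      Finset.add_sum_erase _ f (Finset.mem_erase.2 ⟨hac.symm, Finset.mem_univ c⟩)]
  unfold blueExcess
  rw [key, key fun v => if C v then (1 : ℝ) else 0]
  have h : ∀ v ∈ (Finset.univ.erase a).erase c,
      (if paintEdge s(a, c) b C v then (1 : ℝ) else 0) = if C v then 1 else 0 := by
    intro v hv
    simp only [Finset.mem_erase] at hv
    simp [paintEdge, hv.1, hv.2.1]
  rw [Finset.sum_congr rfl h]
  cases b <;> simp [paintEdge] <;> ring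

lemma stepMean_blueExcess (hV : 2 ≤ Fintype.card V) (C : ColorConfig V) :
    stepMean p (fun e b => blueExcess p (paintEdge e b C)) =
      (1 - 2 / Fintype.card V) * blueExcess p C := by
  have hn : (2 : ℝ) ≤ Fintype.card V := by exact_mod_cast hV
  rw [stepMean_eq_of_indicator hV (fun v => if C v then (1 : ℝ) else 0)
    (by intro v; split_ifs <;> simp) (blueExcess p C + 2 * p) (-1) 0]
  · unfold blueExcess
    field_simp
    ring
  · intro a c hac
    simp only [Fintype.sum_bool, blueExcess_paintEdge C hac, colorProb, ↓reduceIte,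
      Bool.false_eq_true]
    ring

/-- One step multiplies the square by `1 - 4 / n` and adds a bounded term, since at most two
vertices change colour. -/
lemma stepMean_blueExcess_sq_le (h0 : 0 ≤ p) (h1 : p ≤ 1) (hV : 2 ≤ Fintype.card V)
    (C : ColorConfig V) :
    stepMean p (fun e b => blueExcess p (paintEdge e b C) ^ 2) ≤
      (1 - 4 / Fintype.card V) * blueExcess p C ^ 2 + 4 := by
  have hn : (2 : ℝ) ≤ Fintype.card V := by exact_mod_cast hV
  set n : ℝ := (Fintype.card V : ℝ) with hn_def
  set S : ℝ := ∑ v, if C v then (1 : ℝ) else 0 with hS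
  have hS0 : 0 ≤ S := Finset.sum_nonneg fun v _ => by split_ifs <;> simp
  have hS1 : S ≤ n := by
    calc S ≤ ∑ v : V, (1 : ℝ) := Finset.sum_le_sum fun v _ => by split_ifs <;> simp
      _ = n := by simp [hn_def]
  set Y := blueExcess p C with hY
  have hYS : Y = S - n * p := rfl
  rw [stepMean_eq_of_indicator hV (fun v => if C v then (1 : ℝ) else 0)
    (by intro v; split_ifs <;> simp) (Y ^ 2 + 4 * p * Y + 4 * p) (1 - 2 * Y - 4 * p) 2]
  · rw [← hS, ← hn_def]
    obtain ⟨s, hs⟩ : ∃ s, S = n * s := ⟨S / n, by field_simp⟩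
    have hs0 : 0 ≤ s := by by_contra hh; nlinarith
    have hs1 : s ≤ 1 := by by_contra hh; nlinarith
    have e1 : 2 * (1 - 2 * Y - 4 * p) * S / n = 2 * (1 - 2 * Y - 4 * p) * s := by
      rw [hs]; field_simp
    have e2 : 2 * (S * (S - 1)) / (n * (n - 1)) ≤ 2 * s ^ 2 := by
      rw [div_le_iff₀ (by nlinarith), hs]
      nlinarith [mul_nonneg (mul_nonneg (by linarith : 0 ≤ n) hs0) (by linarith : 0 ≤ 1 - s)]
    have e3 : (1 - 4 / n) * Y ^ 2 = Y ^ 2 - 4 * (s - p) * Y := by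
      rw [show (1 - 4 / n) * Y ^ 2 = Y ^ 2 - 4 * (Y / n) * Y by ring, hYS, hs]
      field_simp
    rw [e1, e3]
    have e4 : 0 ≤ (1 - p) * (4 - 2 * s - 2 * s ^ 2) + p * (6 * s - 2 * s ^ 2) :=
      add_nonneg (mul_nonneg (by linarith) (by nlinarith)) (mul_nonneg h0 (by nlinarith))
    nlinarith
  · intro a c hac
    simp only [Fintype.sum_bool, blueExcess_paintEdge C hac, colorProb, ↓reduceIte,
      Bool.false_eq_true, ← hY]
    by_cases ha : C a = true <;> by_cases hc : C c = true <;> simp [ha, hc] <;> ring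

lemma sum_pow_mul_blueExcess (hV : 2 ≤ Fintype.card V) (z : ColorConfig V) (t : ℕ) :
    ∑ y, (stepMatrix p paintEdge ^ t) z y * blueExcess p y =
      (1 - 2 / Fintype.card V) ^ t * blueExcess p z := by
  induction t with
  | zero => simp [Matrix.one_apply]
  | succ t ih =>
    rw [sum_pow_succ_stepMatrix_mul]
    simp only [stepMean_blueExcess hV]
    rw [pow_succ, mul_comm _ (1 - 2 / (Fintype.card V : ℝ)), mul_assoc, ← ih, Finset.mul_sum]
    exact Finset.sum_congr rfl fun y _ => by ring

/-- The number of blue vertices has variance at most `n` at all times. -/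
lemma sum_pow_mul_blueExcess_sq_le (h0 : 0 ≤ p) (h1 : p ≤ 1) (hV : 4 ≤ Fintype.card V)
    (z : ColorConfig V) (t : ℕ) :
    ∑ y, (stepMatrix p paintEdge ^ t) z y * blueExcess p y ^ 2 ≤
      ((1 - 2 / Fintype.card V) ^ t * blueExcess p z) ^ 2 + Fintype.card V := by
  have hn : (4 : ℝ) ≤ Fintype.card V := by exact_mod_cast hV
  have hst : ∀ t, stepMatrix p (paintEdge (V := V)) ^ t ∈ Matrix.rowStochastic ℝ _ :=
    fun t => pow_mem (stepMatrix_mem_rowStochastic h0 h1 (by omega) _) t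
  induction t with
  | zero => simp [Matrix.one_apply]
  | succ t ih =>
    set n : ℝ := (Fintype.card V : ℝ)
    set m := (1 - 2 / n) ^ t * blueExcess p z
    rw [sum_pow_succ_stepMatrix_mul]
    have hn4 : 0 ≤ 1 - 4 / n := by
      rw [sub_nonneg, div_le_one (by linarith)]; exact hn
    calc ∑ y, (stepMatrix p paintEdge ^ t) z y *
          stepMean p (fun e b => blueExcess p (paintEdge e b y) ^ 2)
        ≤ ∑ y, (stepMatrix p paintEdge ^ t) z y * ((1 - 4 / n) * blueExcess p y ^ 2 + 4) :=
          Finset.sum_le_sum fun y _ => mul_le_mul_of_nonneg_left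
            (stepMean_blueExcess_sq_le h0 h1 (by omega) y)
            (Matrix.nonneg_of_mem_rowStochastic (hst t))
      _ = (1 - 4 / n) * ∑ y, (stepMatrix p paintEdge ^ t) z y * blueExcess p y ^ 2 + 4 := by
          simp only [mul_add, Finset.sum_add_distrib, ← Finset.sum_mul,
            Matrix.sum_row_of_mem_rowStochastic (hst t), Finset.mul_sum, one_mul]
          congr 1
          exact Finset.sum_congr rfl fun y _ => by ring
      _ ≤ (1 - 4 / n) * (m ^ 2 + n) + 4 := by
          have := mul_le_mul_of_nonneg_left ih hn4
          linarith
      _ ≤ ((1 - 2 / n) ^ (t + 1) * blueExcess p z) ^ 2 + n := by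
          have e : (1 - 2 / n) ^ (t + 1) * blueExcess p z = (1 - 2 / n) * m := by
            simp only [m]; ring
          have e2 : (1 - 4 / n) * n = n - 4 := by field_simp
          rw [e]
          -- The contraction `1 - 4 / n` of the square is stronger than that of the squared mean.
          have e3 : ((1 - 2 / n) * m) ^ 2 = (1 - 4 / n) * m ^ 2 + (2 / n * m) ^ 2 := by ring
          linarith [sq_nonneg (2 / n * m)]

lemma IsStationaryDistribution.sum_mul_stepMean {Ω : Type*} [Fintype Ω] [DecidableEq Ω]
    {f : Sym2 V → Bool → Ω → Ω} {π : Ω → ℝ} (h : IsStationaryDistribution (stepMatrix p f) π)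
    (g : Ω → ℝ) : ∑ x, π x * stepMean p (fun e b => g (f e b x)) = ∑ x, π x * g x := by
  simp only [← sum_stepMatrix_mul, Finset.mul_sum]
  rw [Finset.sum_comm]
  simp only [← mul_assoc, ← Finset.sum_mul, h.2.2]

lemma IsStationaryDistribution.sum_mul_blueExcess_sq_le (h0 : 0 ≤ p) (h1 : p ≤ 1)
    (hV : 2 ≤ Fintype.card V) {π : ColorConfig V → ℝ}
    (h : IsStationaryDistribution (stepMatrix p paintEdge) π) :
    ∑ x, π x * blueExcess p x ^ 2 ≤ Fintype.card V := by
  have hn : (2 : ℝ) ≤ Fintype.card V := by exact_mod_cast hV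
  have h2 : ∑ x, π x * blueExcess p x ^ 2 ≤
      ∑ x, π x * ((1 - 4 / Fintype.card V) * blueExcess p x ^ 2 + 4) := by
    rw [← h.sum_mul_stepMean (fun x => blueExcess p x ^ 2)]
    exact Finset.sum_le_sum fun x _ => mul_le_mul_of_nonneg_left
      (stepMean_blueExcess_sq_le h0 h1 hV x) (h.1 x)
  simp only [mul_add, Finset.sum_add_distrib, mul_left_comm (π _), ← Finset.mul_sum,
    ← Finset.sum_mul, h.2.1, one_mul] at h2
  set W := ∑ x, π x * blueExcess p x ^ 2
  have h3 : 4 / (Fintype.card V : ℝ) * W ≤ 4 := by linarith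
  rw [div_mul_eq_mul_div, div_le_iff₀ (by linarith)] at h3
  linarith

end Blue

/-- If a statistic `Y` has mean `m` and variance at most `v` under one distribution and second
moment at most `v` under another, the two are at total variation distance at least
`1 - 8 * v / m ^ 2`: Chebyshev's inequality puts `Y` on different sides of `m / 2`. -/
lemma one_sub_le_totalVariation {Ω : Type*} [Fintype Ω] {μ ν Y : Ω → ℝ} {m v : ℝ}
    (hμ : ∀ x, 0 ≤ μ x) (hμ1 : ∑ x, μ x = 1) (hν : ∀ x, 0 ≤ ν x) (hm : 0 < m)
    (hμY : ∑ x, μ x * Y x = m) (hμv : ∑ x, μ x * Y x ^ 2 ≤ m ^ 2 + v)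
    (hνv : ∑ x, ν x * Y x ^ 2 ≤ v) (hν1 : ∑ x, ν x = 1) :
    1 - 8 * v / m ^ 2 ≤ totalVariation μ ν := by
  -- Test against the event `m / 2 < Y`.
  set φ : Ω → ℝ := fun x => if m / 2 < Y x then 1 else 0 with hφ
  have hm2 : 0 < m ^ 2 := by positivity
  have h1 : ∑ x, ν x * φ x ≤ 4 / m ^ 2 * v := by
    refine le_trans ?_ (mul_le_mul_of_nonneg_left hνv (by positivity))
    rw [Finset.mul_sum]
    refine Finset.sum_le_sum fun x _ => ?_
    rw [mul_left_comm]
    refine mul_le_mul_of_nonneg_left ?_ (hν x)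
    simp only [hφ]
    split_ifs with hx
    · rw [div_mul_eq_mul_div, le_div_iff₀ hm2]; nlinarith
    · positivity
  have h2 : ∑ x, μ x * (1 - φ x) ≤ 4 / m ^ 2 * v := by
    have e : ∑ x, μ x * (Y x - m) ^ 2 ≤ v := by
      have : ∀ x, μ x * (Y x - m) ^ 2 = μ x * Y x ^ 2 - 2 * m * (μ x * Y x) + m ^ 2 * μ x :=
        fun x => by ring
      simp only [this, Finset.sum_add_distrib, Finset.sum_sub_distrib, ← Finset.mul_sum, hμ1, hμY]
      nlinarith
    refine le_trans ?_ (mul_le_mul_of_nonneg_left e (by positivity))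
    rw [Finset.mul_sum]
    refine Finset.sum_le_sum fun x _ => ?_
    rw [mul_left_comm]
    refine mul_le_mul_of_nonneg_left ?_ (hμ x)
    simp only [hφ]
    split_ifs with hx
    · simp; positivity
    · rw [div_mul_eq_mul_div, le_div_iff₀ hm2]; nlinarith
  have h3 : ∑ x, (μ x - ν x) * (2 * φ x - 1) ≤ ∑ x, |μ x - ν x| := by
    refine Finset.sum_le_sum fun x _ => (le_abs_self _).trans ?_
    rw [abs_mul]
    refine mul_le_of_le_one_right (abs_nonneg _) ?_
    simp only [hφ]
    split_ifs <;> norm_num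
  have h4 : ∑ x, (μ x - ν x) * (2 * φ x - 1) =
      2 * (1 - ∑ x, μ x * (1 - φ x) - ∑ x, ν x * φ x) := by
    have : ∀ x, (μ x - ν x) * (2 * φ x - 1) =
        2 * (μ x * 1 - μ x * (1 - φ x) - ν x * φ x) - μ x + ν x := fun x => by ring
    simp only [this, Finset.sum_add_distrib, Finset.sum_sub_distrib, ← Finset.mul_sum, mul_one, hμ1,
      hν1]
    ring
  unfold totalVariation
  have e5 : 8 * v / m ^ 2 = 2 * (4 / m ^ 2 * v) := by ring
  rw [e5]
  linarith

/-- The lower bound: from the all-blue configuration the mean number of blue vertices still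
exceeds its stationary value after `t` steps. -/
lemma one_sub_le_distToStationary {V : Type*} [Fintype V] [DecidableEq V] {p : ℝ}
    (h0 : 0 < p) (h1 : p < 1) (hV : 4 ≤ Fintype.card V) {π : ColorConfig V → ℝ}
    (h : IsStationaryDistribution (stepMatrix p paintEdge) π) (t : ℕ) :
    1 - 8 / ((1 - p) ^ 2 * (Fintype.card V * (1 - 2 / Fintype.card V) ^ (2 * t))) ≤
      distToStationary (stepMatrix p paintEdge) π t := by
  have hn : (4 : ℝ) ≤ Fintype.card V := by exact_mod_cast hV
  have hst := pow_mem
    (stepMatrix_mem_rowStochastic h0.le h1.le (by omega) (paintEdge (V := V))) t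
  refine le_trans ?_ (totalVariation_le_distToStationary _ π t fun _ => true)
  have hz : blueExcess p (fun _ : V => true) = Fintype.card V * (1 - p) := by
    simp [blueExcess]; ring
  have hn2 : (0 : ℝ) < 1 - 2 / Fintype.card V := by
    rw [sub_pos, div_lt_one (by linarith)]; linarith
  have hq : 0 < 1 - p := by linarith
  have hn0 : (0 : ℝ) < Fintype.card V := by linarith
  refine le_trans (le_of_eq ?_) (one_sub_le_totalVariation (Y := blueExcess p)
    (fun x => Matrix.nonneg_of_mem_rowStochastic hst) (Matrix.sum_row_of_mem_rowStochastic hst _)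
    h.1 ?_ (sum_pow_mul_blueExcess (by omega) _ t) (sum_pow_mul_blueExcess_sq_le h0.le h1.le hV _ t)
    (h.sum_mul_blueExcess_sq_le h0.le h1.le (by omega)) h.2.1)
  · rw [hz]
    have := pow_pos hn2 t
    rw [mul_comm 2 t, pow_mul]
    field_simp
  · rw [hz]; positivity

/-! ### The dual chain: revealing the edges backwards in time -/

/-- What is known about the final colour of a vertex when the edges of the last steps have been
revealed, the most recent one first: no revealed edge covers it (`untouched`), its last covering
edge has another endpoint that is repainted later (`single`), or its last covering edge is also the
last one of the other endpoint and has colour `b` (`paired b`). Only the colour of a pair is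
recorded; the colour of a single vertex remains random. -/
inductive VertexStatus
  | untouched
  | single
  | paired (b : Bool)
  deriving DecidableEq, Fintype

/-- The status after an untouched vertex has received a fresh random colour. -/
def VertexStatus.release : VertexStatus → VertexStatus
  | untouched => single
  | single => single
  | paired b => paired b

/-- The effect on the statuses of revealing one more edge `e` of colour `b`, which is earlier in
time than the edges revealed so far. -/
def revealEdge {V : Type*} [Fintype V] [DecidableEq V] (e : Sym2 V) (b : Bool)
    (l : V → VertexStatus) : V → VertexStatus :=
  fun v => if v ∈ e ∧ l v = .untouched then
    if ∀ w ∈ e, l w = .untouched then .paired b else .single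
  else l v

/-- The law of the final colour of a vertex given its status and its initial colour `z`. -/
noncomputable def siteLaw (p : ℝ) : VertexStatus → Bool → Bool → ℝ
  | .untouched, z, x => if z = x then 1 else 0
  | .single, _, x => colorProb p x
  | .paired b, _, x => if b = x then 1 else 0

/-- The law of the final configuration given the statuses `l` and the initial configuration `z`. -/
noncomputable def configLaw {V : Type*} [Fintype V] (p : ℝ) (l : V → VertexStatus)
    (z x : ColorConfig V) : ℝ :=
  ∏ v, siteLaw p (l v) (z v) (x v)

section Dual

variable {V : Type*} [Fintype V] [DecidableEq V] {p : ℝ}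

lemma revealEdge_left (l : V → VertexStatus) (a c : V) (b : Bool) :
    revealEdge s(a, c) b l a = if l a = .untouched then
      if l c = .untouched then .paired b else .single else l a := by
  by_cases ha : l a = .untouched <;> simp [revealEdge, ha]

lemma revealEdge_right (l : V → VertexStatus) (a c : V) (b : Bool) :
    revealEdge s(a, c) b l c = if l c = .untouched then
      if l a = .untouched then .paired b else .single else l c := by
  rw [Sym2.eq_swap, revealEdge_left]

lemma revealEdge_of_ne (l : V → VertexStatus) {a c v : V} (ha : v ≠ a) (hc : v ≠ c) (b : Bool) :
    revealEdge s(a, c) b l v = l v := by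
  simp [revealEdge, ha, hc]

/-- The duality between painting the initial configuration and revealing an earlier edge. -/
lemma stepMean_configLaw_paintEdge (l : V → VertexStatus) (z x : ColorConfig V) :
    stepMean p (fun e b => configLaw p l (paintEdge e b z) x) =
      stepMean p (fun e b => configLaw p (revealEdge e b l) z x) := by
  unfold stepMean
  congr 1
  refine Finset.sum_congr rfl fun a _ => Finset.sum_congr rfl fun c _ => ?_
  split_ifs with hac
  · rfl
  have key : ∀ f : V → ℝ, ∏ v, f v = f a * f c * ∏ v ∈ (Finset.univ.erase a).erase c, f v := by
    intro f
    rw [← Finset.mul_prod_erase _ f (Finset.mem_univ a), mul_assoc,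
      Finset.mul_prod_erase _ f (Finset.mem_erase.2 ⟨Ne.symm hac, Finset.mem_univ c⟩)]
  set R := ∏ v ∈ (Finset.univ.erase a).erase c, siteLaw p (l v) (z v) (x v)
  have hL : ∀ b, configLaw p l (paintEdge s(a, c) b z) x =
      siteLaw p (l a) b (x a) * siteLaw p (l c) b (x c) * R := by
    intro b
    unfold configLaw
    rw [key]
    congr 1
    · simp [paintEdge]
    · refine Finset.prod_congr rfl fun v hv => ?_
      simp only [Finset.mem_erase] at hv
      simp [paintEdge, hv.1, hv.2.1]
  have hR : ∀ b, configLaw p (revealEdge s(a, c) b l) z x =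
      siteLaw p (revealEdge s(a, c) b l a) (z a) (x a) *
        siteLaw p (revealEdge s(a, c) b l c) (z c) (x c) * R := by
    intro b
    unfold configLaw
    rw [key]
    congr 1
    refine Finset.prod_congr rfl fun v hv => ?_
    simp only [Finset.mem_erase] at hv
    rw [revealEdge_of_ne l hv.2.1 hv.1]
  simp only [hL, hR, revealEdge_left, revealEdge_right, Fintype.sum_bool]
  cases hla : l a <;> cases hlc : l c <;> cases hxa : x a <;> cases hxc : x c <;>
    simp [siteLaw, colorProb] <;> (try split_ifs) <;> ring

/-- Running the dual chain from the state in which every vertex is untouched gives the law of edge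
flipping, for all initial configurations simultaneously. -/
lemma pow_paintEdge_apply (z x : ColorConfig V) (t : ℕ) :
    (stepMatrix p paintEdge ^ t) z x =
      ∑ l, (stepMatrix p (revealEdge (V := V)) ^ t) (fun _ => .untouched) l *
        configLaw p l z x := by
  induction t generalizing z with
  | zero =>
    simp only [pow_zero, Matrix.one_apply, ite_mul, one_mul, zero_mul, Finset.sum_ite_eq,
      Finset.mem_univ, if_true, configLaw, siteLaw]
    rw [Fintype.prod_ite_zero]
    simp [funext_iff]
  | succ t ih =>
    rw [sum_pow_succ_stepMatrix_mul, pow_succ', Matrix.mul_apply, sum_stepMatrix_mul]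
    simp only [ih]
    rw [stepMean_sum]
    simp only [stepMean_const_mul, stepMean_configLaw_paintEdge]

lemma revealEdge_comp (σ : Equiv.Perm V) (e : Sym2 V) (b : Bool) (l : V → VertexStatus) :
    revealEdge e b (l ∘ σ) = revealEdge (e.map σ) b l ∘ σ := by
  funext v
  simp [revealEdge, Sym2.mem_map]

lemma stepMatrix_revealEdge_comp (σ : Equiv.Perm V) (l l' : V → VertexStatus) :
    stepMatrix p revealEdge (l ∘ σ) (l' ∘ σ) = stepMatrix p revealEdge l l' := by
  unfold stepMatrix
  rw [← stepMean_map σ fun e b => if revealEdge e b l = l' then (1 : ℝ) else 0]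
  simp only [revealEdge_comp, (Equiv.surjective σ).injective_comp_right.eq_iff]

/-- The dual chain started from the symmetric state is exchangeable. -/
lemma pow_revealEdge_comp (σ : Equiv.Perm V) (l l' : V → VertexStatus) (t : ℕ) :
    (stepMatrix p revealEdge ^ t) (l ∘ σ) (l' ∘ σ) = (stepMatrix p revealEdge ^ t) l l' := by
  induction t generalizing l' with
  | zero => simp [Matrix.one_apply, (Equiv.surjective σ).injective_comp_right.eq_iff]
  | succ t ih =>
    simp only [pow_succ, Matrix.mul_apply]
    rw [← Equiv.sum_comp (Equiv.arrowCongr σ.symm (Equiv.refl VertexStatus))]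
    refine Finset.sum_congr rfl fun y _ => ?_
    have : (Equiv.arrowCongr σ.symm (Equiv.refl VertexStatus)) y = y ∘ σ := by ext; simp
    rw [this, ih, stepMatrix_revealEdge_comp]

/-! ### Untouched and unpaired vertices -/

/-- The set of vertices that no revealed edge covers. -/
def untouchedSet (l : V → VertexStatus) : Finset V := {v | l v = .untouched}

/-- The set of vertices that are not in a revealed pair. -/
def freeSet (l : V → VertexStatus) : Finset V := {v | (l v).release = .single}

lemma cast_card_untouchedSet {V : Type*} [Fintype V] (l : V → VertexStatus) :
    ((untouchedSet l).card : ℝ) = ∑ v, if l v = .untouched then (1 : ℝ) else 0 := by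
  simp [untouchedSet]

lemma cast_card_freeSet {V : Type*} [Fintype V] (l : V → VertexStatus) :
    ((freeSet l).card : ℝ) = ∑ v, if (l v).release = .single then (1 : ℝ) else 0 := by
  simp [freeSet]

lemma sum_eq_add_add_sum_erase {a c : V} (hac : a ≠ c) (f : V → ℝ) :
    ∑ v, f v = f a + f c + ∑ v ∈ (Finset.univ.erase a).erase c, f v := by
  rw [← Finset.add_sum_erase _ f (Finset.mem_univ a), add_assoc,
    Finset.add_sum_erase _ f (Finset.mem_erase.2 ⟨hac.symm, Finset.mem_univ c⟩)]

lemma card_untouchedSet_revealEdge (l : V → VertexStatus) {a c : V} (hac : a ≠ c) (b : Bool) :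
    ((untouchedSet (revealEdge s(a, c) b l)).card : ℝ) = (untouchedSet l).card -
      ((if l a = .untouched then 1 else 0) + (if l c = .untouched then 1 else 0)) := by
  rw [cast_card_untouchedSet, cast_card_untouchedSet, sum_eq_add_add_sum_erase hac,
    sum_eq_add_add_sum_erase hac fun v => if l v = .untouched then (1 : ℝ) else 0]
  have h : ∀ v ∈ (Finset.univ.erase a).erase c,
      (if revealEdge s(a, c) b l v = .untouched then (1 : ℝ) else 0) =
        if l v = .untouched then 1 else 0 := by
    intro v hv
    simp only [Finset.mem_erase] at hv
    rw [revealEdge_of_ne l hv.2.1 hv.1]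
  rw [Finset.sum_congr rfl h, revealEdge_left, revealEdge_right]
  by_cases ha : l a = .untouched <;> by_cases hc : l c = .untouched <;> simp [ha, hc]

lemma card_freeSet_revealEdge (l : V → VertexStatus) {a c : V} (hac : a ≠ c) (b : Bool) :
    ((freeSet (revealEdge s(a, c) b l)).card : ℝ) = (freeSet l).card -
      2 * ((if l a = .untouched then 1 else 0) * (if l c = .untouched then 1 else 0)) := by
  rw [cast_card_freeSet, cast_card_freeSet, sum_eq_add_add_sum_erase hac,
    sum_eq_add_add_sum_erase hac fun v => if (l v).release = .single then (1 : ℝ) else 0]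
  have h : ∀ v ∈ (Finset.univ.erase a).erase c,
      (if (revealEdge s(a, c) b l v).release = .single then (1 : ℝ) else 0) =
        if (l v).release = .single then 1 else 0 := by
    intro v hv
    simp only [Finset.mem_erase] at hv
    rw [revealEdge_of_ne l hv.2.1 hv.1]
  rw [Finset.sum_congr rfl h, revealEdge_left, revealEdge_right]
  have h₁ : VertexStatus.untouched.release = .single := rfl
  have h₂ : VertexStatus.single.release = .single := rfl
  have h₃ : (VertexStatus.paired b).release = .paired b := rfl
  by_cases ha : l a = .untouched <;> by_cases hc : l c = .untouched <;>
    simp [ha, hc, h₁, h₂, h₃]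
  ring

lemma stepMean_card_untouchedSet (hV : 2 ≤ Fintype.card V) (l : V → VertexStatus) :
    stepMean p (fun e b => ((untouchedSet (revealEdge e b l)).card : ℝ)) =
      (1 - 2 / Fintype.card V) * (untouchedSet l).card := by
  rw [stepMean_eq_of_indicator hV (fun v => if l v = .untouched then (1 : ℝ) else 0)
    (by intro v; split_ifs <;> simp) ((untouchedSet l).card) (-1) 0,
    ← cast_card_untouchedSet]
  · ring
  · intro a c hac
    simp only [Fintype.sum_bool, card_untouchedSet_revealEdge l hac, colorProb, ↓reduceIte,
      Bool.false_eq_true]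
    ring

lemma sum_pow_mul_card_untouchedSet (hV : 2 ≤ Fintype.card V) (t : ℕ) :
    ∑ l, (stepMatrix p (revealEdge (V := V)) ^ t) (fun _ => .untouched) l *
      ((untouchedSet l).card : ℝ) = Fintype.card V * (1 - 2 / Fintype.card V) ^ t := by
  induction t with
  | zero => simp [Matrix.one_apply, untouchedSet]
  | succ t ih =>
    rw [sum_pow_succ_stepMatrix_mul]
    simp only [stepMean_card_untouchedSet hV, mul_left_comm _ (1 - 2 / (Fintype.card V : ℝ)),
      ← Finset.mul_sum, ih]
    ring

/-- A Lyapunov function for the dual chain with `f` free and `u` untouched vertices out of `n`.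
The expression in the square is a martingale, with bounded increments that vanish at the steps that
touch no new vertex; the term `4 * u` compensates the growth of its variance. -/
noncomputable def pairLyapunov (n f u : ℝ) : ℝ :=
  (n - f + u * (u - 1) / (2 * n - 3) - n * (n - 1) / (2 * n - 3)) ^ 2 + 4 * u

/-- The drift of `pairLyapunov` is nonpositive: at a step with one new vertex `(f, u)` becomes
`(f, u - 1)`, at a step with two it becomes `(f - 2, u - 2)`. -/
lemma pairLyapunov_drift_nonpos {n f : ℝ} {k : ℕ} (hn : 2 ≤ n) (hk : (k : ℝ) ≤ n) :
    2 * k * (n - k) * (pairLyapunov n f (k - 1) - pairLyapunov n f k) +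
      k * (k - 1) * (pairLyapunov n (f - 2) (k - 2) - pairLyapunov n f k) ≤ 0 := by
  have hd : 0 < 2 * n - 3 := by linarith
  set u : ℝ := (k : ℝ) with hu
  set X := n - f + u * (u - 1) / (2 * n - 3) - n * (n - 1) / (2 * n - 3) with hX
  set δ₁ := -2 * (u - 1) / (2 * n - 3) with h₁
  set δ₂ := 2 - (4 * u - 6) / (2 * n - 3) with h₂
  have e1 : pairLyapunov n f (u - 1) - pairLyapunov n f u = 2 * X * δ₁ + δ₁ ^ 2 - 4 := by
    simp only [pairLyapunov, hX, h₁]; ring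
  have e2 : pairLyapunov n (f - 2) (u - 2) - pairLyapunov n f u = 2 * X * δ₂ + δ₂ ^ 2 - 8 := by
    simp only [pairLyapunov, hX, h₂]; ring
  have e3 : 2 * u * (n - u) * δ₁ + u * (u - 1) * δ₂ = 0 := by
    simp only [h₁, h₂]; field_simp; ring
  rw [e1, e2]
  have g1 : u * (n - u) * (δ₁ ^ 2 - 4) ≤ 0 := by
    rcases Nat.eq_zero_or_pos k with h | h
    · simp [hu, h]
    · have hu1 : 1 ≤ u := by rw [hu]; exact_mod_cast h
      refine mul_nonpos_of_nonneg_of_nonpos (mul_nonneg (by linarith) (by linarith)) ?_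
      have a1 : δ₁ ≤ 0 := div_nonpos_of_nonpos_of_nonneg (by linarith) hd.le
      have a2 : -2 ≤ δ₁ := by rw [h₁, le_div_iff₀ hd]; linarith
      nlinarith
  have g2 : u * (u - 1) * (δ₂ ^ 2 - 8) ≤ 0 := by
    rcases Nat.lt_or_ge k 2 with h | h
    · interval_cases k <;> simp [hu]
    · have hu1 : 2 ≤ u := by rw [hu]; exact_mod_cast h
      refine mul_nonpos_of_nonneg_of_nonpos (mul_nonneg (by linarith) (by linarith)) ?_
      have a1 : δ₂ ≤ 2 := by
        have : 0 ≤ (4 * u - 6) / (2 * n - 3) := div_nonneg (by linarith) hd.le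
        linarith
      have a2 : 0 ≤ δ₂ := by
        have : (4 * u - 6) / (2 * n - 3) ≤ 2 := by rw [div_le_iff₀ hd]; linarith
        linarith
      nlinarith
  have : 2 * u * (n - u) * (2 * X * δ₁ + δ₁ ^ 2 - 4) + u * (u - 1) * (2 * X * δ₂ + δ₂ ^ 2 - 8) =
      2 * X * (2 * u * (n - u) * δ₁ + u * (u - 1) * δ₂) + 2 * (u * (n - u) * (δ₁ ^ 2 - 4)) +
        u * (u - 1) * (δ₂ ^ 2 - 8) := by ring
  rw [this, e3]
  linarith

lemma card_untouchedSet_le {V : Type*} [Fintype V]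
    (l : V → VertexStatus) : (untouchedSet l).card ≤ Fintype.card V :=
  Finset.card_le_univ _

lemma stepMean_pairLyapunov_le (hV : 2 ≤ Fintype.card V) (l : V → VertexStatus) :
    stepMean p (fun e b => pairLyapunov (Fintype.card V) (freeSet (revealEdge e b l)).card
      (untouchedSet (revealEdge e b l)).card) ≤
      pairLyapunov (Fintype.card V) (freeSet l).card (untouchedSet l).card := by
  have hn : (2 : ℝ) ≤ Fintype.card V := by exact_mod_cast hV
  have hk : ((untouchedSet l).card : ℝ) ≤ Fintype.card V := by
    exact_mod_cast card_untouchedSet_le l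
  have hdrift := pairLyapunov_drift_nonpos (f := (freeSet l).card) hn hk
  set n : ℝ := (Fintype.card V : ℝ)
  set f : ℝ := ((freeSet l).card : ℝ)
  set u : ℝ := ((untouchedSet l).card : ℝ) with hu
  rw [stepMean_eq_of_indicator hV (fun v => if l v = .untouched then (1 : ℝ) else 0)
    (by intro v; split_ifs <;> simp) (pairLyapunov n f u)
    (pairLyapunov n f (u - 1) - pairLyapunov n f u)
    (pairLyapunov n (f - 2) (u - 2) - pairLyapunov n f u -
      2 * (pairLyapunov n f (u - 1) - pairLyapunov n f u)), ← cast_card_untouchedSet, ← hu]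
  · set D₁ := pairLyapunov n f (u - 1) - pairLyapunov n f u
    set D₂ := pairLyapunov n (f - 2) (u - 2) - pairLyapunov n f u
    have h1 : (n - 1) ≠ 0 := by linarith
    have h2 : 2 * D₁ * u / n + (D₂ - 2 * D₁) * (u * (u - 1)) / (n * (n - 1)) =
        (2 * u * (n - u) * D₁ + u * (u - 1) * D₂) / (n * (n - 1)) := by
      field_simp
      ring
    have h3 : (2 * u * (n - u) * D₁ + u * (u - 1) * D₂) / (n * (n - 1)) ≤ 0 :=
      div_nonpos_of_nonpos_of_nonneg hdrift (by nlinarith)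
    linarith
  · intro a c hac
    simp only [card_untouchedSet_revealEdge l hac, card_freeSet_revealEdge l hac,
      ← Finset.sum_mul, sum_colorProb, one_mul]
    by_cases ha : l a = .untouched <;> by_cases hc : l c = .untouched <;> simp [ha, hc] <;>
      norm_num <;> ring

lemma sum_pow_mul_pairLyapunov_le (h0 : 0 ≤ p) (h1 : p ≤ 1) (hV : 2 ≤ Fintype.card V) (t : ℕ) :
    ∑ l, (stepMatrix p (revealEdge (V := V)) ^ t) (fun _ => .untouched) l *
      pairLyapunov (Fintype.card V) (freeSet l).card (untouchedSet l).card ≤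
      4 * Fintype.card V := by
  induction t with
  | zero =>
    simp [Matrix.one_apply, untouchedSet, freeSet, VertexStatus.release, pairLyapunov]
  | succ t ih =>
    refine le_trans ?_ ih
    rw [sum_pow_succ_stepMatrix_mul _ _
      fun l => pairLyapunov (Fintype.card V) (freeSet l).card (untouchedSet l).card]
    exact Finset.sum_le_sum fun l _ => mul_le_mul_of_nonneg_left (stepMean_pairLyapunov_le hV l)
      (Matrix.nonneg_of_mem_rowStochastic
        (pow_mem (stepMatrix_mem_rowStochastic h0 h1 hV _) t))

/-- With high probability at least a quarter of the vertices are not in revealed pairs. -/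
lemma sum_pow_card_freeSet_lt_le (h0 : 0 ≤ p) (h1 : p ≤ 1) (hV : 4 ≤ Fintype.card V) (t : ℕ) :
    ∑ l, (stepMatrix p (revealEdge (V := V)) ^ t) (fun _ => .untouched) l *
      (if 4 * (freeSet l).card < Fintype.card V then (1 : ℝ) else 0) ≤ 256 / Fintype.card V := by
  have hn : (4 : ℝ) ≤ Fintype.card V := by exact_mod_cast hV
  have hL := sum_pow_mul_pairLyapunov_le (V := V) h0 h1 (by omega) t
  set n : ℝ := (Fintype.card V : ℝ) with hn_def
  have key : ∀ l : V → VertexStatus, (if 4 * (freeSet l).card < Fintype.card V then (1 : ℝ) else 0)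
      ≤ 64 / n ^ 2 * pairLyapunov n (freeSet l).card (untouchedSet l).card := by
    intro l
    split_ifs with h
    · have hf : 4 * ((freeSet l).card : ℝ) < n := by rw [hn_def]; exact_mod_cast h
      have hu : (0 : ℝ) ≤ (untouchedSet l).card * ((untouchedSet l).card - 1) := by
        rcases Nat.eq_zero_or_pos (untouchedSet l).card with h | h
        · simp [h]
        · have : (1 : ℝ) ≤ (untouchedSet l).card := by exact_mod_cast h
          exact mul_nonneg (by linarith) (by linarith)
      have hd : 0 < 2 * n - 3 := by linarith
      have h1 := div_nonneg hu hd.le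
      -- More than `3 / 4 * n` paired vertices, against an expected `n / 2` in the limit.
      have h2 : n * (n - 1) / (2 * n - 3) ≤ 5 / 8 * n := by
        rw [div_le_iff₀ hd]; nlinarith
      have h3 : n ^ 2 / 64 ≤ pairLyapunov n (freeSet l).card (untouchedSet l).card := by
        have h4 : n / 8 ≤ n - (freeSet l).card +
            (untouchedSet l).card * ((untouchedSet l).card - 1) / (2 * n - 3) -
              n * (n - 1) / (2 * n - 3) := by linarith
        have h5 := pow_le_pow_left₀ (by linarith) h4 2
        have h6 : (0 : ℝ) ≤ (untouchedSet l).card := Nat.cast_nonneg _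
        unfold pairLyapunov
        linarith
      rw [div_mul_eq_mul_div, le_div_iff₀ (by positivity)]
      linarith
    · unfold pairLyapunov; positivity
  calc _ ≤ ∑ l, (stepMatrix p (revealEdge (V := V)) ^ t) (fun _ => .untouched) l *
        (64 / n ^ 2 * pairLyapunov n (freeSet l).card (untouchedSet l).card) :=
        Finset.sum_le_sum fun l _ => mul_le_mul_of_nonneg_left (key l)
          (Matrix.nonneg_of_mem_rowStochastic
            (pow_mem (stepMatrix_mem_rowStochastic h0 h1 (by omega) _) t))
    _ ≤ 64 / n ^ 2 * (4 * n) := by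
        simp only [mul_left_comm _ (64 / n ^ 2), ← Finset.mul_sum]
        exact mul_le_mul_of_nonneg_left hL (by positivity)
    _ = 256 / n := by field_simp; norm_num

end Dual

/-! ### Exchangeability of the untouched vertices -/

section Classes

variable {V : Type*} [Fintype V] [DecidableEq V] {p : ℝ}

/-- The revealed pairs with their colours, and the number of untouched vertices. Given this
information, the untouched vertices are a uniformly random subset of the free ones. -/
def statusKey (l : V → VertexStatus) : (V → VertexStatus) × ℕ :=
  (fun v => (l v).release, (untouchedSet l).card)

/-- The status functions with the same pairs and as many untouched vertices as `l₀`. -/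
def statusClass (l₀ : V → VertexStatus) : Finset (V → VertexStatus) :=
  {l | statusKey l = statusKey l₀}

lemma mem_statusClass {l l₀ : V → VertexStatus} :
    l ∈ statusClass l₀ ↔ statusKey l = statusKey l₀ := by simp [statusClass]

lemma self_mem_statusClass (l : V → VertexStatus) : l ∈ statusClass l := by simp [statusClass]

lemma release_eq_of_statusKey_eq {V : Type*} [Fintype V]
    {l l' : V → VertexStatus} (h : statusKey l = statusKey l') (v : V) :
    (l v).release = (l' v).release := congrFun (congrArg Prod.fst h) v

lemma card_untouchedSet_eq_of_statusKey_eq {V : Type*} [Fintype V] {l l' : V → VertexStatus}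
    (h : statusKey l = statusKey l') : (untouchedSet l).card = (untouchedSet l').card :=
  congrArg Prod.snd h

lemma untouchedSet_subset_freeSet {V : Type*} [Fintype V]
    (l : V → VertexStatus) : untouchedSet l ⊆ freeSet l := by
  intro v hv
  simp only [untouchedSet, freeSet, Finset.mem_filter, Finset.mem_univ, true_and] at hv ⊢
  rw [hv]; rfl

lemma card_filter_single (l : V → VertexStatus) :
    (Finset.univ.filter fun v => l v = .single).card =
      (freeSet l).card - (untouchedSet l).card := by
  rw [← Finset.card_sdiff_of_subset (untouchedSet_subset_freeSet l)]
  congr 1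
  ext v
  simp only [untouchedSet, freeSet, Finset.mem_filter, Finset.mem_univ, true_and, Finset.mem_sdiff]
  cases l v <;> simp [VertexStatus.release]

lemma freeSet_eq_of_statusKey_eq {V : Type*} [Fintype V]
    {l l' : V → VertexStatus} (h : statusKey l = statusKey l') :
    freeSet l = freeSet l' := by
  ext v; simp [freeSet, release_eq_of_statusKey_eq h]

/-- Status functions with the same key are related by a permutation of the vertices. -/
lemma exists_comp_eq_of_statusKey_eq {l l' : V → VertexStatus} (h : statusKey l = statusKey l') :
    ∃ σ : Equiv.Perm V, l = l' ∘ σ := by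
  have hc : ∀ s, Fintype.card {v // l v = s} = Fintype.card {v // l' v = s} := by
    intro s
    rw [Fintype.card_subtype, Fintype.card_subtype]
    cases s with
    | untouched => exact card_untouchedSet_eq_of_statusKey_eq h
    | single =>
      rw [card_filter_single, card_filter_single, freeSet_eq_of_statusKey_eq h,
        card_untouchedSet_eq_of_statusKey_eq h]
    | paired b =>
      congr 1
      ext v
      have := release_eq_of_statusKey_eq h v
      simp only [Finset.mem_filter, Finset.mem_univ, true_and]
      cases hl : l v <;> cases hl' : l' v <;> simp_all [VertexStatus.release]
  refine ⟨Equiv.ofFiberEquiv (f := l) (g := l') fun s => Fintype.equivOfCardEq (hc s), ?_⟩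
  funext v
  exact (Equiv.ofFiberEquiv_map _ v).symm

lemma pow_revealEdge_eq_of_statusKey_eq {l l' : V → VertexStatus} (h : statusKey l = statusKey l')
    (t : ℕ) : (stepMatrix p revealEdge ^ t) (fun _ => .untouched) l =
      (stepMatrix p revealEdge ^ t) (fun _ => .untouched) l' := by
  obtain ⟨σ, rfl⟩ := exists_comp_eq_of_statusKey_eq h
  exact pow_revealEdge_comp σ (fun _ => .untouched) l' t

/-- Averaging over classes on which the weight is constant does not change a weighted sum. -/
lemma sum_mul_eq_sum_mul_average {Ω κ : Type*} [Fintype Ω] [DecidableEq κ] (key : Ω → κ)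
    {w : Ω → ℝ} (hw : ∀ a b, key a = key b → w a = w b) (d : Ω → ℝ) :
    ∑ a, w a * d a = ∑ a, w a * ((∑ b with key b = key a, d b) /
      (Finset.univ.filter fun b => key b = key a).card) := by
  set c : κ → ℝ := fun k => ((Finset.univ.filter fun b => key b = k).card : ℝ) with hc
  have hpos : ∀ a, c (key a) ≠ 0 := by
    intro a
    simp only [hc, ne_eq, Nat.cast_eq_zero, Finset.card_eq_zero]
    exact Finset.nonempty_iff_ne_empty.1 ⟨a, by simp⟩
  have h1 : ∀ a, w a * ((∑ b with key b = key a, d b) / c (key a)) =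
      ∑ b, if key b = key a then w b * d b / c (key b) else 0 := by
    intro a
    rw [← mul_div_assoc, Finset.mul_sum, Finset.sum_div, Finset.sum_filter]
    refine Finset.sum_congr rfl fun b _ => ?_
    split_ifs with h
    · rw [hw b a h, h]
    · rfl
  rw [Finset.sum_congr rfl fun a _ => h1 a, Finset.sum_comm]
  refine Finset.sum_congr rfl fun b _ => ?_
  rw [← Finset.sum_filter, Finset.sum_const, nsmul_eq_mul]
  have : ((Finset.univ.filter fun a => key b = key a).card : ℝ) = c (key b) := by
    simp only [hc, eq_comm]
  rw [this]
  have := hpos b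
  field_simp

lemma card_statusClass_filter (l₀ : V → VertexStatus) (J : Finset V) :
    ((statusClass l₀).filter fun l => J ⊆ untouchedSet l).card =
      (((freeSet l₀).powersetCard (untouchedSet l₀).card).filter (J ⊆ ·)).card := by
  have hrel : ∀ U ⊆ freeSet l₀, ∀ v,
      (if v ∈ U then VertexStatus.untouched else (l₀ v).release).release = (l₀ v).release := by
    intro U hU v
    split_ifs with hv
    · have := hU hv
      simp only [freeSet, Finset.mem_filter, Finset.mem_univ, true_and] at this
      rw [this]; rfl
    · cases l₀ v <;> rfl
  have hunt : ∀ U : Finset V, untouchedSet (fun v => if v ∈ U then VertexStatus.untouched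
      else (l₀ v).release) = U := by
    intro U
    ext v
    simp only [untouchedSet, Finset.mem_filter, Finset.mem_univ, true_and]
    by_cases hv : v ∈ U
    · simp [hv]
    · simp only [hv, if_false, iff_false]
      cases l₀ v <;> simp [VertexStatus.release]
  refine Finset.card_nbij' untouchedSet
    (fun U v => if v ∈ U then VertexStatus.untouched else (l₀ v).release) ?_ ?_ ?_ ?_
  · intro l hl
    simp only [Finset.coe_filter, mem_statusClass, Set.mem_ofPred_eq, Finset.mem_powersetCard]
      at hl ⊢
    refine ⟨⟨?_, card_untouchedSet_eq_of_statusKey_eq hl.1⟩, hl.2⟩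
    rw [← freeSet_eq_of_statusKey_eq hl.1]
    exact untouchedSet_subset_freeSet l
  · intro U hU
    simp only [Finset.coe_filter, mem_statusClass, Set.mem_ofPred_eq, Finset.mem_powersetCard]
      at hU ⊢
    rw [hunt]
    refine ⟨?_, hU.2⟩
    unfold statusKey
    rw [hunt, hU.1.2]
    congr 1
    funext v
    exact hrel U hU.1.1 v
  · intro l hl
    simp only [Finset.coe_filter, mem_statusClass, Set.mem_ofPred_eq] at hl
    funext v
    have := release_eq_of_statusKey_eq hl.1 v
    simp only [untouchedSet, Finset.mem_filter, Finset.mem_univ, true_and]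
    split_ifs with hv
    · exact hv.symm
    · rw [← this]
      cases h : l v
      · exact absurd h hv
      · rfl
      · rfl
  · intro U _
    exact hunt U

lemma choose_sub_le (N u j : ℕ) (hj : j ≤ u) (hu : u ≤ N) :
    ((N - j).choose (u - j) : ℝ) ≤ N.choose u * ((u : ℝ) / N) ^ j := by
  induction j with
  | zero => simp
  | succ j ih =>
    have ih := ih (by omega)
    have h := Nat.add_one_mul_choose_eq (N - (j + 1)) (u - (j + 1))
    have e1 : N - (j + 1) + 1 = N - j := by omega
    have e2 : u - (j + 1) + 1 = u - j := by omega
    rw [e1, e2] at h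
    have h' : ((N : ℝ) - j) * ((N - (j + 1)).choose (u - (j + 1)) : ℝ) =
        ((N - j).choose (u - j) : ℝ) * ((u : ℝ) - j) := by
      have := congrArg (Nat.cast (R := ℝ)) h
      rwa [Nat.cast_mul, Nat.cast_mul, Nat.cast_sub (by omega), Nat.cast_sub (by omega)] at this
    have hNj : (0 : ℝ) < (N : ℝ) - j := by
      have : (j : ℝ) + 1 ≤ N := by exact_mod_cast hj.trans hu
      linarith
    have hN : (0 : ℝ) < N := by
      have : (0 : ℝ) ≤ j := Nat.cast_nonneg j
      linarith
    have huN : (u : ℝ) ≤ N := by exact_mod_cast hu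
    have hr : ((u : ℝ) - j) / (N - j) ≤ u / N := by
      rw [div_le_div_iff₀ hNj hN]
      have := mul_le_mul_of_nonneg_right huN (Nat.cast_nonneg (α := ℝ) j)
      nlinarith
    have e : ((N - (j + 1)).choose (u - (j + 1)) : ℝ) =
        ((N - j).choose (u - j) : ℝ) * (((u : ℝ) - j) / (N - j)) := by
      rw [← mul_div_assoc, ← h']; field_simp
    calc _ = ((N - j).choose (u - j) : ℝ) * (((u : ℝ) - j) / (N - j)) := e
      _ ≤ ((N - j).choose (u - j) : ℝ) * (u / N) :=
          mul_le_mul_of_nonneg_left hr (Nat.cast_nonneg _)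
      _ ≤ (N.choose u * ((u : ℝ) / N) ^ j) * (u / N) :=
          mul_le_mul_of_nonneg_right ih (by positivity)
      _ = _ := by ring

/-- A uniformly random set of `u` out of `N` free vertices contains a given set `J` with
probability at most `(u / N) ^ #J`. -/
lemma card_statusClass_filter_le (l₀ : V → VertexStatus) (J : Finset V) (hJ : J ⊆ freeSet l₀) :
    (((statusClass l₀).filter fun l => J ⊆ untouchedSet l).card : ℝ) ≤
      (statusClass l₀).card * (((untouchedSet l₀).card : ℝ) / (freeSet l₀).card) ^ J.card := by
  have h0 : (statusClass l₀).card = (freeSet l₀).card.choose (untouchedSet l₀).card := by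
    simpa using card_statusClass_filter l₀ ∅
  rw [card_statusClass_filter, h0]
  rcases le_or_gt J.card (untouchedSet l₀).card with h | h
  · rw [Finset.card_filter_powersetCard_subset _ _ _ hJ h]
    exact choose_sub_le _ _ _ h (Finset.card_le_card (untouchedSet_subset_freeSet l₀))
  · have : (((freeSet l₀).powersetCard (untouchedSet l₀).card).filter (J ⊆ ·)) = ∅ := by
      refine Finset.filter_eq_empty_iff.2 fun U hU hJU => ?_
      have := Finset.card_le_card hJU
      rw [(Finset.mem_powersetCard.1 hU).2] at this
      omega
    rw [this]
    simp only [Finset.card_empty, Nat.cast_zero]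
    positivity

/-- The exponential moment of the overlap of two independent random untouched sets. -/
lemma sum_sum_prod_one_add_le (l₀ : V → VertexStatus) {K : ℝ} (hK : 0 ≤ K) :
    ∑ l ∈ statusClass l₀, ∑ l' ∈ statusClass l₀, ∏ v ∈ freeSet l₀,
      (1 + if v ∈ untouchedSet l ∧ v ∈ untouchedSet l' then K else 0) ≤
      (statusClass l₀).card ^ 2 *
        Real.exp (K * (untouchedSet l₀).card ^ 2 / (freeSet l₀).card) := by
  set F := statusClass l₀
  set N : ℝ := ((freeSet l₀).card : ℝ) with hN
  set u : ℝ := ((untouchedSet l₀).card : ℝ)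
  have h1 : ∀ l l' : V → VertexStatus, ∀ J : Finset V,
      ∏ v ∈ J, (if v ∈ untouchedSet l ∧ v ∈ untouchedSet l' then K else 0) =
      K ^ J.card * ((if J ⊆ untouchedSet l then 1 else 0) *
        (if J ⊆ untouchedSet l' then 1 else 0)) := by
    intro l l' J
    by_cases h : J ⊆ untouchedSet l ∧ J ⊆ untouchedSet l'
    · rw [Finset.prod_congr rfl (g := fun _ => K) fun v hv => if_pos ⟨h.1 hv, h.2 hv⟩]
      simp [h.1, h.2]
    · have h' : ∃ v ∈ J, ¬(v ∈ untouchedSet l ∧ v ∈ untouchedSet l') := by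
        by_contra! hh
        exact h ⟨fun v hv => (hh v hv).1, fun v hv => (hh v hv).2⟩
      obtain ⟨v, hv, hv'⟩ := h'
      rw [Finset.prod_eq_zero hv (if_neg hv')]
      rw [not_and_or] at h
      rcases h with h | h <;> simp [h]
  have h2 : ∀ J : Finset V, ∑ l ∈ F, ∑ l' ∈ F, K ^ J.card *
      ((if J ⊆ untouchedSet l then (1 : ℝ) else 0) * (if J ⊆ untouchedSet l' then 1 else 0)) =
      K ^ J.card * ((F.filter fun l => J ⊆ untouchedSet l).card : ℝ) ^ 2 := by
    intro J
    simp only [← Finset.mul_sum, ← Finset.sum_mul]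
    rw [Finset.sum_boole]
    ring
  -- Expand the product over the subsets `J` of the overlap; the double sum then factorizes.
  calc _ = ∑ l ∈ F, ∑ l' ∈ F, ∑ J ∈ (freeSet l₀).powerset, K ^ J.card *
      ((if J ⊆ untouchedSet l then (1 : ℝ) else 0) * (if J ⊆ untouchedSet l' then 1 else 0)) := by
        simp only [Finset.prod_one_add, h1]
    _ = ∑ J ∈ (freeSet l₀).powerset, K ^ J.card *
        ((F.filter fun l => J ⊆ untouchedSet l).card : ℝ) ^ 2 := by
        simp only [← h2]
        rw [Finset.sum_comm]
        conv_rhs => rw [Finset.sum_comm]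
        rw [Finset.sum_comm]
        refine Finset.sum_congr rfl fun l _ => ?_
        rw [Finset.sum_comm]
    _ ≤ ∑ J ∈ (freeSet l₀).powerset, K ^ J.card * (F.card * (u / N) ^ J.card) ^ 2 := by
        refine Finset.sum_le_sum fun J hJ => ?_
        have := card_statusClass_filter_le l₀ J (Finset.mem_powerset.1 hJ)
        gcongr
    _ = (F.card : ℝ) ^ 2 * ∑ J ∈ (freeSet l₀).powerset, ∏ _v ∈ J, (K * (u / N) ^ 2) := by
        rw [Finset.mul_sum]
        refine Finset.sum_congr rfl fun J _ => ?_
        rw [Finset.prod_const, mul_pow, mul_pow, ← pow_mul, ← pow_mul]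
        ring
    _ = (F.card : ℝ) ^ 2 * (1 + K * (u / N) ^ 2) ^ (freeSet l₀).card := by
        rw [← Finset.prod_one_add, Finset.prod_const]
    _ ≤ (F.card : ℝ) ^ 2 * Real.exp (K * (u / N) ^ 2) ^ (freeSet l₀).card := by
        gcongr
        rw [add_comm]
        exact Real.add_one_le_exp _
    _ = _ := by
        rw [← Real.exp_nat_mul, ← hN]
        congr 2
        rcases eq_or_ne N 0 with h | h
        · simp [h]
        · field_simp

/-! ### Second moment bound on a class -/

/-- The law of the final configuration given the statuses `l` when the untouched vertices are
coloured afresh. -/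
noncomputable def freshLaw (p : ℝ) (l : V → VertexStatus) (x : ColorConfig V) : ℝ :=
  ∏ v, siteLaw p (l v).release true (x v)

/-- The density of `configLaw p l z` with respect to `freshLaw p l`. -/
noncomputable def freshDensity (p : ℝ) (l : V → VertexStatus) (z x : ColorConfig V) : ℝ :=
  ∏ v, if l v = .untouched then (if z v = x v then (colorProb p (z v))⁻¹ else 0) else 1

lemma colorProb_pos (h0 : 0 < p) (h1 : p < 1) (b : Bool) : 0 < colorProb p b := by
  cases b <;> simp [colorProb] <;> linarith

lemma siteLaw_nonneg (h0 : 0 ≤ p) (h1 : p ≤ 1) (s : VertexStatus) (z x : Bool) :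
    0 ≤ siteLaw p s z x := by
  cases s <;> simp only [siteLaw]
  · split_ifs <;> simp
  · exact colorProb_nonneg h0 h1 x
  · split_ifs <;> simp

lemma sum_siteLaw (s : VertexStatus) (z : Bool) : ∑ x, siteLaw p s z x = 1 := by
  cases s with
  | untouched => simp only [siteLaw]; simp
  | single => exact sum_colorProb p
  | paired b => simp only [siteLaw]; simp

lemma configLaw_nonneg {V : Type*} [Fintype V]
    (h0 : 0 ≤ p) (h1 : p ≤ 1) (l : V → VertexStatus) (z x : ColorConfig V) :
    0 ≤ configLaw p l z x := Finset.prod_nonneg fun _ _ => siteLaw_nonneg h0 h1 _ _ _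

lemma freshLaw_nonneg {V : Type*} [Fintype V]
    (h0 : 0 ≤ p) (h1 : p ≤ 1) (l : V → VertexStatus) (x : ColorConfig V) :
    0 ≤ freshLaw p l x := Finset.prod_nonneg fun _ _ => siteLaw_nonneg h0 h1 _ _ _

lemma sum_configLaw (l : V → VertexStatus) (z : ColorConfig V) : ∑ x, configLaw p l z x = 1 := by
  unfold configLaw
  rw [← Fintype.prod_sum fun v b => siteLaw p (l v) (z v) b]
  simp only [sum_siteLaw, Finset.prod_const_one]

lemma sum_freshLaw (l : V → VertexStatus) : ∑ x, freshLaw p l x = 1 := by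
  unfold freshLaw
  rw [← Fintype.prod_sum fun v b => siteLaw p (l v).release true b]
  simp only [sum_siteLaw, Finset.prod_const_one]

lemma freshLaw_eq_of_statusKey_eq {V : Type*} [Fintype V]
    {l l' : V → VertexStatus} (h : statusKey l = statusKey l')
    (x : ColorConfig V) : freshLaw p l x = freshLaw p l' x := by
  unfold freshLaw
  simp only [release_eq_of_statusKey_eq h]

lemma configLaw_eq_freshLaw_mul {V : Type*} [Fintype V]
    (h0 : 0 < p) (h1 : p < 1) (l : V → VertexStatus)
    (z x : ColorConfig V) : configLaw p l z x = freshLaw p l x * freshDensity p l z x := by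
  unfold configLaw freshLaw freshDensity
  rw [← Finset.prod_mul_distrib]
  refine Finset.prod_congr rfl fun v _ => ?_
  have := (colorProb_pos h0 h1 (z v)).ne'
  cases l v
  · simp only [siteLaw, VertexStatus.release, if_true]
    split_ifs with h
    · rw [← h, mul_inv_cancel₀ this]
    · simp
  · simp [siteLaw, VertexStatus.release]
  · simp [siteLaw, VertexStatus.release]

lemma inv_colorProb_le (h0 : 0 < p) (h1 : p < 1) (b : Bool) :
    (colorProb p b)⁻¹ ≤ 1 / (p * (1 - p)) := by
  have hq : 0 < 1 - p := by linarith
  rw [← one_div]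
  refine one_div_le_one_div_of_le (mul_pos h0 hq) ?_
  cases b <;> simp [colorProb] <;> nlinarith

/-- Distinct densities of a class interact only at common untouched vertices. -/
lemma sum_freshLaw_mul_freshDensity_mul_le (h0 : 0 < p) (h1 : p < 1) (l₀ l l' : V → VertexStatus)
    (hl : l ∈ statusClass l₀) (hl' : l' ∈ statusClass l₀) (z : ColorConfig V) :
    ∑ x, freshLaw p l₀ x * (freshDensity p l z x * freshDensity p l' z x) ≤
      ∏ v ∈ freeSet l₀,
        (1 + if v ∈ untouchedSet l ∧ v ∈ untouchedSet l' then 1 / (p * (1 - p)) else 0) := by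
  have hK : 0 < 1 / (p * (1 - p)) := by
    have : 0 < 1 - p := by linarith
    positivity
  rw [Finset.prod_subset (Finset.subset_univ (freeSet l₀))]
  swap
  · intro v _ hv
    rw [if_neg, add_zero]
    rintro ⟨h, -⟩
    rw [← freeSet_eq_of_statusKey_eq (mem_statusClass.1 hl)] at hv
    exact hv (untouchedSet_subset_freeSet l h)
  unfold freshLaw freshDensity
  simp only [← Finset.prod_mul_distrib]
  rw [← Fintype.prod_sum fun v b => siteLaw p (l₀ v).release true b *
    ((if l v = .untouched then (if z v = b then (colorProb p (z v))⁻¹ else 0) else 1) *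
      (if l' v = .untouched then (if z v = b then (colorProb p (z v))⁻¹ else 0) else 1))]
  have hsite : ∀ v b, 0 ≤ (if l v = .untouched then
      (if z v = b then (colorProb p (z v))⁻¹ else 0) else 1 : ℝ) := by
    intro v b
    have := inv_pos.2 (colorProb_pos h0 h1 (z v))
    split_ifs <;> linarith
  have hsite' : ∀ v b, 0 ≤ (if l' v = .untouched then
      (if z v = b then (colorProb p (z v))⁻¹ else 0) else 1 : ℝ) := by
    intro v b
    have := inv_pos.2 (colorProb_pos h0 h1 (z v))
    split_ifs <;> linarith
  refine Finset.prod_le_prod (fun v _ => Finset.sum_nonneg fun b _ => mul_nonneg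
    (siteLaw_nonneg h0.le h1.le _ _ _) (mul_nonneg (hsite v b) (hsite' v b))) fun v _ => ?_
  have hz := (colorProb_pos h0 h1 (z v)).ne'
  have hb := inv_colorProb_le h0 h1 (z v)
  have r := release_eq_of_statusKey_eq (mem_statusClass.1 hl) v
  have r' := release_eq_of_statusKey_eq (mem_statusClass.1 hl') v
  simp only [untouchedSet, Finset.mem_filter, Finset.mem_univ, true_and]
  by_cases hu : l v = .untouched <;> by_cases hu' : l' v = .untouched
  · have e : (l₀ v).release = .single := by rw [← r, hu]; rfl
    simp only [e, hu, hu', if_true, siteLaw, and_self, ite_mul, mul_ite, zero_mul, mul_zero,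
      Finset.sum_ite_eq, Finset.mem_univ]
    rw [mul_inv_cancel_left₀ hz]
    linarith
  · have e : (l₀ v).release = .single := by rw [← r, hu]; rfl
    simp [e, hu, hu', siteLaw, hz]
  · have e : (l₀ v).release = .single := by rw [← r', hu']; rfl
    simp [e, hu, hu', siteLaw, hz]
  · simp only [hu, hu', if_false, mul_one, sum_siteLaw, and_self, add_zero, le_refl]

/-- The second moment bound: averaged over a class, the law started at `z` is close to the law in
which the untouched vertices are coloured afresh, as soon as the number of untouched vertices is
small compared to the square root of the number of free ones. -/
lemma sum_abs_sum_configLaw_sub_le_sqrt (h0 : 0 < p) (h1 : p < 1) (l₀ : V → VertexStatus)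
    (z : ColorConfig V) :
    ∑ x, |∑ l ∈ statusClass l₀, (configLaw p l z x - freshLaw p l x)| ≤
      (statusClass l₀).card * √(Real.exp
        (1 / (p * (1 - p)) * (untouchedSet l₀).card ^ 2 / (freeSet l₀).card) - 1) := by
  set F := statusClass l₀
  set E := Real.exp (1 / (p * (1 - p)) * (untouchedSet l₀).card ^ 2 / (freeSet l₀).card)
  set m := freshLaw p l₀
  have hm : ∀ x, 0 ≤ m x := freshLaw_nonneg h0.le h1.le l₀
  have hmF : ∀ l ∈ F, ∀ x, freshLaw p l x = m x := fun l hl x =>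
    freshLaw_eq_of_statusKey_eq (mem_statusClass.1 hl) x
  set g := fun l x => freshDensity p l z x
  have hmg : ∀ l ∈ F, ∀ x, configLaw p l z x = m x * g l x := fun l hl x => by
    rw [configLaw_eq_freshLaw_mul h0 h1, hmF l hl]
  have hsum : ∀ x, ∑ l ∈ F, (configLaw p l z x - freshLaw p l x) =
      m x * (∑ l ∈ F, g l x - F.card) := by
    intro x
    rw [Finset.sum_congr rfl fun l hl => by rw [hmg l hl, hmF l hl], Finset.sum_sub_distrib,
      ← Finset.mul_sum, Finset.sum_const, nsmul_eq_mul]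
    ring
  have hone : ∑ x, m x * ∑ l ∈ F, g l x = F.card := by
    simp only [Finset.mul_sum]
    rw [Finset.sum_comm, Finset.sum_congr rfl (g := fun _ => (1 : ℝ)) fun l hl => by
      rw [← sum_configLaw (p := p) l z]
      exact Finset.sum_congr rfl fun x _ => (hmg l hl x).symm]
    simp
  have htwo : ∑ x, m x * (∑ l ∈ F, g l x) ^ 2 ≤ (F.card : ℝ) ^ 2 * E := by
    refine le_trans (le_of_eq ?_) (le_trans (Finset.sum_le_sum fun l hl =>
      Finset.sum_le_sum fun l' hl' => sum_freshLaw_mul_freshDensity_mul_le h0 h1 l₀ l l' hl hl' z)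
      (sum_sum_prod_one_add_le l₀ ?_))
    · have e : ∀ x, m x * (∑ l ∈ F, g l x) ^ 2 =
          ∑ l ∈ F, ∑ l' ∈ F, m x * (g l x * g l' x) := fun x => by
        rw [sq, Finset.sum_mul_sum]
        simp only [Finset.mul_sum]
      rw [Finset.sum_congr rfl fun x _ => e x, Finset.sum_comm]
      exact Finset.sum_congr rfl fun l _ => Finset.sum_comm
    · have : 0 < 1 - p := by linarith
      positivity
  have hvar : ∑ x, m x * (∑ l ∈ F, g l x - F.card) ^ 2 ≤ (F.card : ℝ) ^ 2 * (E - 1) := by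
    have : ∀ x, m x * (∑ l ∈ F, g l x - F.card) ^ 2 = m x * (∑ l ∈ F, g l x) ^ 2 -
        2 * F.card * (m x * ∑ l ∈ F, g l x) + F.card ^ 2 * m x := fun x => by ring
    simp only [this, Finset.sum_add_distrib, Finset.sum_sub_distrib, ← Finset.mul_sum, hone]
    rw [sum_freshLaw]
    nlinarith
  -- Cauchy-Schwarz with respect to the probability distribution `m`.
  have hcs := Finset.sum_sq_le_sum_mul_sum_of_sq_le_mul Finset.univ
    (r := fun x => |m x * (∑ l ∈ F, g l x - F.card)|) (f := m)
    (g := fun x => m x * (∑ l ∈ F, g l x - F.card) ^ 2) (fun x _ => hm x)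
    (fun x _ => mul_nonneg (hm x) (sq_nonneg _)) (fun x _ => le_of_eq (by rw [sq_abs]; ring))
  rw [sum_freshLaw, one_mul] at hcs
  simp only [hsum]
  refine (Real.le_sqrt_of_sq_le (hcs.trans hvar)).trans (le_of_eq ?_)
  rw [Real.sqrt_mul (sq_nonneg _), Real.sqrt_sq (Nat.cast_nonneg _)]

lemma sum_abs_configLaw_sub_le_two (h0 : 0 ≤ p) (h1 : p ≤ 1) (l : V → VertexStatus)
    (z : ColorConfig V) : ∑ x, |configLaw p l z x - freshLaw p l x| ≤ 2 :=
  sum_abs_le_two (configLaw_nonneg h0 h1 l z) (sum_configLaw l z) (freshLaw_nonneg h0 h1 l)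
    (sum_freshLaw l)

lemma sum_abs_sum_configLaw_sub_le_two (h0 : 0 ≤ p) (h1 : p ≤ 1) (l₀ : V → VertexStatus)
    (z : ColorConfig V) :
    ∑ x, |∑ l ∈ statusClass l₀, (configLaw p l z x - freshLaw p l x)| ≤
      (statusClass l₀).card * 2 := by
  calc _ ≤ ∑ x, ∑ l ∈ statusClass l₀, |configLaw p l z x - freshLaw p l x| :=
        Finset.sum_le_sum fun x _ => Finset.abs_sum_le_sum_abs _ _
    _ = ∑ l ∈ statusClass l₀, ∑ x, |configLaw p l z x - freshLaw p l x| := Finset.sum_comm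
    _ ≤ ∑ l ∈ statusClass l₀, 2 :=
        Finset.sum_le_sum fun l _ => sum_abs_configLaw_sub_le_two h0 h1 l z
    _ = _ := by simp

/-- The bound on a class, in a form that is linear in the number of untouched vertices. -/
lemma sum_abs_sum_configLaw_sub_le (h0 : 0 < p) (h1 : p < 1) (l₀ : V → VertexStatus)
    (z : ColorConfig V) :
    ∑ x, |∑ l ∈ statusClass l₀, (configLaw p l z x - freshLaw p l x)| ≤
      (statusClass l₀).card * (4 * √(1 / (p * (1 - p)) / Fintype.card V) * (untouchedSet l₀).card +
        2 * if 4 * (freeSet l₀).card < Fintype.card V then 1 else 0) := by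
  have hq : 0 < 1 - p := by linarith
  have htriv := sum_abs_sum_configLaw_sub_le_two h0.le h1.le l₀ z
  set K := 1 / (p * (1 - p)) with hKdef
  have hK : 0 < K := by positivity
  set r := √(K / Fintype.card V)
  have hr : 0 ≤ r := Real.sqrt_nonneg _
  set u : ℝ := ((untouchedSet l₀).card : ℝ)
  have hu : 0 ≤ u := Nat.cast_nonneg _
  have hr2 : r ^ 2 = K / Fintype.card V := Real.sq_sqrt (by positivity)
  split_ifs with hN
  · refine htriv.trans (mul_le_mul_of_nonneg_left ?_ (Nat.cast_nonneg _))
    have := mul_nonneg hr hu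
    linarith
  rw [mul_zero, add_zero]
  -- For `2 * (r * u) ≤ 1` the exponent is small and `exp y - 1 ≤ y + y ^ 2`; otherwise the trivial
  -- bound `2` is smaller than the claimed one.
  rcases le_or_gt (2 * (r * u)) 1 with h | h
  · refine (sum_abs_sum_configLaw_sub_le_sqrt h0 h1 l₀ z).trans
      (mul_le_mul_of_nonneg_left ?_ (Nat.cast_nonneg _))
    rw [← hKdef]
    set y := K * u ^ 2 / (freeSet l₀).card with hy
    have hy0 : 0 ≤ y := by positivity
    have hy1 : y ≤ 4 * (r * u) ^ 2 := by
      rw [mul_pow, hr2]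
      have hN' : (Fintype.card V : ℝ) ≤ 4 * (freeSet l₀).card := by
        exact_mod_cast not_lt.1 hN
      rcases Nat.eq_zero_or_pos (freeSet l₀).card with hz | hz
      · rw [hy, hz]; simp; positivity
      have hf : (0 : ℝ) < (freeSet l₀).card := by exact_mod_cast hz
      have hn : (0 : ℝ) < Fintype.card V := by
        exact_mod_cast lt_of_lt_of_le hz (Finset.card_le_univ _)
      rw [hy, show 4 * (K / Fintype.card V * u ^ 2) = 4 * (K * u ^ 2) / Fintype.card V by ring,
        div_le_div_iff₀ hf hn]
      have : 0 ≤ K * u ^ 2 := by positivity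
      nlinarith
    have hru := mul_nonneg hr hu
    have hy2 : y ≤ 1 := by nlinarith
    have hexp := abs_le.1 (Real.abs_exp_sub_one_sub_id_le (x := y) (by rwa [abs_of_nonneg hy0]))
    refine Real.sqrt_le_iff.2 ⟨by positivity, ?_⟩
    nlinarith [hexp.2]
  · refine htriv.trans (mul_le_mul_of_nonneg_left ?_ (Nat.cast_nonneg _))
    linarith

/-! ### Distance to stationarity -/

/-- The law after `t` steps when the initial colours are independent with probability `p` of
blue. -/
noncomputable def freshStartLaw (p : ℝ) (t : ℕ) (x : ColorConfig V) : ℝ :=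
  ∑ l, (stepMatrix p (revealEdge (V := V)) ^ t) (fun _ => .untouched) l * freshLaw p l x

/-- The upper bound: the first term is the imprint of the initial configuration on the untouched
vertices, the second the probability that too many vertices are in pairs. -/
lemma sum_abs_pow_sub_freshStartLaw_le (h0 : 0 < p) (h1 : p < 1) (hV : 4 ≤ Fintype.card V)
    (z : ColorConfig V) (t : ℕ) :
    ∑ x, |(stepMatrix p paintEdge ^ t) z x - freshStartLaw p t x| ≤
      4 * √(1 / (p * (1 - p)) / Fintype.card V) *
        (Fintype.card V * (1 - 2 / Fintype.card V) ^ t) + 512 / Fintype.card V := by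
  set w := (stepMatrix p (revealEdge (V := V)) ^ t) (fun _ => .untouched) with hw
  have hw0 : ∀ l, 0 ≤ w l := fun l => Matrix.nonneg_of_mem_rowStochastic
    (pow_mem (stepMatrix_mem_rowStochastic h0.le h1.le (by omega) _) t)
  have hpos : ∀ l : V → VertexStatus, (0 : ℝ) < (statusClass l).card := fun l => by
    exact_mod_cast Finset.card_pos.2 ⟨l, self_mem_statusClass l⟩
  have hx : ∀ x, (stepMatrix p paintEdge ^ t) z x - freshStartLaw p t x =
      ∑ l₀, w l₀ * ((∑ l ∈ statusClass l₀, (configLaw p l z x - freshLaw p l x)) /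
        (statusClass l₀).card) := by
    intro x
    rw [pow_paintEdge_apply, freshStartLaw, ← Finset.sum_sub_distrib]
    simp only [← mul_sub]
    exact sum_mul_eq_sum_mul_average statusKey
      (fun a b h => pow_revealEdge_eq_of_statusKey_eq h t) _
  have hU := sum_pow_mul_card_untouchedSet (V := V) (p := p) (by omega) t
  have hF := sum_pow_card_freeSet_lt_le (V := V) h0.le h1.le hV t
  rw [← hw] at hU hF
  set r := √(1 / (p * (1 - p)) / Fintype.card V)
  calc _ ≤ ∑ x, ∑ l₀, w l₀ * (|∑ l ∈ statusClass l₀, (configLaw p l z x - freshLaw p l x)| /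
        (statusClass l₀).card) := by
        refine Finset.sum_le_sum fun x _ => ?_
        rw [hx]
        refine (Finset.abs_sum_le_sum_abs _ _).trans (le_of_eq ?_)
        refine Finset.sum_congr rfl fun l₀ _ => ?_
        rw [abs_mul, abs_div, abs_of_nonneg (hw0 l₀), abs_of_pos (hpos l₀)]
    _ = ∑ l₀, w l₀ * ((∑ x, |∑ l ∈ statusClass l₀, (configLaw p l z x - freshLaw p l x)|) /
        (statusClass l₀).card) := by
        rw [Finset.sum_comm]
        simp only [Finset.mul_sum, Finset.sum_div]
    _ ≤ ∑ l₀, w l₀ * (4 * r * (untouchedSet l₀).card +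
        2 * if 4 * (freeSet l₀).card < Fintype.card V then 1 else 0) := by
        refine Finset.sum_le_sum fun l₀ _ => mul_le_mul_of_nonneg_left ?_ (hw0 l₀)
        rw [div_le_iff₀' (hpos l₀)]
        exact sum_abs_sum_configLaw_sub_le h0 h1 l₀ z
    _ = 4 * r * ∑ l, w l * ((untouchedSet l).card : ℝ) + 2 * ∑ l, w l *
        (if 4 * (freeSet l).card < Fintype.card V then (1 : ℝ) else 0) := by
        simp only [mul_add, Finset.sum_add_distrib, Finset.mul_sum]
        congr 1 <;> exact Finset.sum_congr rfl fun l _ => by ring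
    _ ≤ _ := by
        rw [hU]
        have : 512 / (Fintype.card V : ℝ) = 2 * (256 / Fintype.card V) := by ring
        linarith

/-- A bound that holds on a fixed graph and tends to `0` with time: the initial configuration is
forgotten once every vertex has been touched. -/
lemma sum_abs_pow_sub_freshStartLaw_le_geometric (h0 : 0 ≤ p) (h1 : p ≤ 1)
    (hV : 2 ≤ Fintype.card V) (z : ColorConfig V) (t : ℕ) :
    ∑ x, |(stepMatrix p paintEdge ^ t) z x - freshStartLaw p t x| ≤
      2 * Fintype.card V * (1 - 2 / Fintype.card V) ^ t := by
  set w := (stepMatrix p (revealEdge (V := V)) ^ t) (fun _ => .untouched) with hw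
  have hw0 : ∀ l, 0 ≤ w l := fun l => Matrix.nonneg_of_mem_rowStochastic
    (pow_mem (stepMatrix_mem_rowStochastic h0 h1 hV _) t)
  have hU := sum_pow_mul_card_untouchedSet (V := V) (p := p) hV t
  rw [← hw] at hU
  have hl : ∀ l : V → VertexStatus, ∑ x, |configLaw p l z x - freshLaw p l x| ≤
      2 * (untouchedSet l).card := by
    intro l
    rcases Nat.eq_zero_or_pos (untouchedSet l).card with h | h
    · have hne : ∀ v, l v ≠ .untouched := fun v hv => by
        have : v ∈ untouchedSet l := by simp [untouchedSet, hv]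
        rw [Finset.card_eq_zero.1 h] at this
        simp at this
      have : ∀ x, configLaw p l z x = freshLaw p l x := fun x =>
        Finset.prod_congr rfl fun v _ => by
          have := hne v
          cases hv : l v <;> simp_all [siteLaw, VertexStatus.release]
      simp [this, h]
    · have : (1 : ℝ) ≤ (untouchedSet l).card := by exact_mod_cast h
      linarith [sum_abs_configLaw_sub_le_two h0 h1 l z]
  calc _ ≤ ∑ x, ∑ l, w l * |configLaw p l z x - freshLaw p l x| := by
        refine Finset.sum_le_sum fun x _ => ?_
        rw [pow_paintEdge_apply, freshStartLaw, ← Finset.sum_sub_distrib]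
        simp only [← mul_sub]
        refine (Finset.abs_sum_le_sum_abs _ _).trans (le_of_eq ?_)
        exact Finset.sum_congr rfl fun l _ => by rw [abs_mul, abs_of_nonneg (hw0 l)]
    _ = ∑ l, w l * ∑ x, |configLaw p l z x - freshLaw p l x| := by
        rw [Finset.sum_comm]; simp only [Finset.mul_sum]
    _ ≤ ∑ l, w l * (2 * (untouchedSet l).card) :=
        Finset.sum_le_sum fun l _ => mul_le_mul_of_nonneg_left (hl l) (hw0 l)
    _ = _ := by
        simp only [mul_left_comm _ (2 : ℝ), ← Finset.mul_sum, hU]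
        ring

end Classes

/-! ### Existence and uniqueness of the stationary distribution -/

section Stationary

variable {V : Type*} [Fintype V] [DecidableEq V] {p : ℝ}

lemma tendsto_mul_one_sub_two_div_pow {V : Type*} [Fintype V] (hV : 2 ≤ Fintype.card V) (r : ℝ) :
    Tendsto (fun t : ℕ => r * (1 - 2 / (Fintype.card V : ℝ)) ^ t) atTop (𝓝 0) := by
  have hn : (2 : ℝ) ≤ Fintype.card V := by exact_mod_cast hV
  have h1 : 0 ≤ 1 - 2 / (Fintype.card V : ℝ) := by
    rw [sub_nonneg, div_le_one (by linarith)]; exact hn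
  have h2 : 0 < 2 / (Fintype.card V : ℝ) := by positivity
  simpa using (tendsto_pow_atTop_nhds_zero_of_lt_one h1 (by linarith)).const_mul r

/-- All stationary distributions are the limit of the laws `freshStartLaw p t`. -/
lemma IsStationaryDistribution.eq (h0 : 0 ≤ p) (h1 : p ≤ 1) (hV : 2 ≤ Fintype.card V)
    {π ρ : ColorConfig V → ℝ} (hπ : IsStationaryDistribution (stepMatrix p paintEdge) π)
    (hρ : IsStationaryDistribution (stepMatrix p paintEdge) ρ) : π = ρ := by
  funext x
  have hb : ∀ {ν : ColorConfig V → ℝ}, IsStationaryDistribution (stepMatrix p paintEdge) ν →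
      Tendsto (fun t => freshStartLaw p t x) atTop (𝓝 (ν x)) := by
    intro ν hν
    rw [tendsto_iff_dist_tendsto_zero]
    refine squeeze_zero (fun _ => dist_nonneg) (fun t => ?_)
      (tendsto_mul_one_sub_two_div_pow hV (2 * Fintype.card V))
    rw [dist_comm, Real.dist_eq]
    exact (Finset.single_le_sum (f := fun x => |ν x - freshStartLaw p t x|)
      (fun _ _ => abs_nonneg _) (Finset.mem_univ x)).trans (hν.sum_abs_sub_le fun z =>
        sum_abs_pow_sub_freshStartLaw_le_geometric h0 h1 hV z t)
  exact tendsto_nhds_unique (hb hπ) (hb hρ)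

/-- A stationary distribution is obtained as the limit of the laws of the chain started from the
all-blue configuration, which form a Cauchy sequence. -/
lemma exists_isStationaryDistribution (h0 : 0 ≤ p) (h1 : p ≤ 1) (hV : 2 ≤ Fintype.card V) :
    ∃ π : ColorConfig V → ℝ, IsStationaryDistribution (stepMatrix p paintEdge) π := by
  set P := stepMatrix p (paintEdge (V := V)) with hP
  have hst : ∀ t, P ^ t ∈ Matrix.rowStochastic ℝ _ :=
    fun t => pow_mem (stepMatrix_mem_rowStochastic h0 h1 hV _) t
  have hP0 : ∀ t x y, 0 ≤ (P ^ t) x y := fun t x y => Matrix.nonneg_of_mem_rowStochastic (hst t)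
  have hP1 : ∀ t x, ∑ y, (P ^ t) x y = 1 := fun t x => Matrix.sum_row_of_mem_rowStochastic (hst t) x
  have hn : (2 : ℝ) ≤ Fintype.card V := by exact_mod_cast hV
  set n : ℝ := (Fintype.card V : ℝ)
  let z₀ : ColorConfig V := fun _ => true
  have hb : ∀ t z x, |(P ^ t) z x - freshStartLaw p t x| ≤ 2 * n * (1 - 2 / n) ^ t :=
    fun t z x => (Finset.single_le_sum (f := fun x => |(P ^ t) z x - freshStartLaw p t x|)
      (fun _ _ => abs_nonneg _) (Finset.mem_univ x)).trans
        (sum_abs_pow_sub_freshStartLaw_le_geometric h0 h1 hV z t)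
  have hb' : ∀ t x, |(P ^ (t + 1)) z₀ x - freshStartLaw p t x| ≤ 2 * n * (1 - 2 / n) ^ t := by
    intro t x
    have e : (P ^ (t + 1)) z₀ x - freshStartLaw p t x =
        ∑ y, (P ^ 1) z₀ y * ((P ^ t) y x - freshStartLaw p t x) := by
      simp only [mul_sub, Finset.sum_sub_distrib, ← Finset.sum_mul, hP1, one_mul]
      rw [add_comm, pow_add, Matrix.mul_apply]
    rw [e]
    refine (Finset.abs_sum_le_sum_abs _ _).trans ?_
    calc _ ≤ ∑ y, (P ^ 1) z₀ y * (2 * n * (1 - 2 / n) ^ t) := Finset.sum_le_sum fun y _ => by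
          rw [abs_mul, abs_of_nonneg (hP0 1 z₀ y)]
          exact mul_le_mul_of_nonneg_left (hb t y x) (hP0 1 z₀ y)
      _ = _ := by rw [← Finset.sum_mul, hP1, one_mul]
  have hlim : ∀ x, ∃ a, Tendsto (fun t => (P ^ t) z₀ x) atTop (𝓝 a) := by
    intro x
    refine cauchySeq_tendsto_of_complete
      (cauchySeq_of_le_geometric (1 - 2 / n) (4 * n) ?_ fun t => ?_)
    · have : 0 < 2 / n := by positivity
      linarith
    · rw [Real.dist_eq]
      have h1 := abs_le.1 (hb t z₀ x)
      have h2 := abs_le.1 (hb' t x)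
      rw [abs_le]
      constructor <;> linarith [h1.1, h1.2, h2.1, h2.2]
  choose π hπ using hlim
  refine ⟨π, fun x => ge_of_tendsto' (hπ x) fun t => hP0 t z₀ x, ?_, fun y => ?_⟩
  · refine tendsto_nhds_unique (tendsto_finsetSum _ fun x _ => hπ x) ?_
    simp only [hP1]
    exact tendsto_const_nhds
  · refine tendsto_nhds_unique (tendsto_finsetSum _ fun x _ => (hπ x).mul_const (P x y)) ?_
    have := (tendsto_add_atTop_iff_nat 1).2 (hπ y)
    simpa only [pow_succ, Matrix.mul_apply] using this

end Stationary

/-! ### Asymptotics -/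

/-- At time `t = n log n / 4 + γ n` the mean number of untouched vertices is of order
`√n * exp (-2 * γ)`. The factor `exp 1` absorbs the rounding of the time to an integer. -/
lemma card_mul_one_sub_pow_le {n γ : ℝ} (hn : 2 ≤ n) {t : ℕ}
    (ht : 1 / 4 * n * Real.log n + γ * n - 1 ≤ t) :
    n * (1 - 2 / n) ^ t ≤ √n * Real.exp (1 - 2 * γ) := by
  have hn0 : 0 < n := by linarith
  have h2 : 2 / n ≤ 1 := by rw [div_le_one hn0]; exact hn
  have hsq : √n = Real.exp (Real.log n / 2) := by
    rw [← Real.log_sqrt hn0.le, Real.exp_log (Real.sqrt_pos.2 hn0)]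
  calc n * (1 - 2 / n) ^ t ≤ n * Real.exp (-(2 / n)) ^ t := by
        have := pow_le_pow_left₀ (sub_nonneg.2 h2) (Real.one_sub_le_exp_neg (2 / n)) t
        gcongr
    _ = Real.exp (Real.log n + t * (-(2 / n))) := by
        rw [Real.exp_add, Real.exp_log hn0, Real.exp_nat_mul]
    _ ≤ Real.exp (Real.log n / 2 + (1 - 2 * γ)) := by
        refine Real.exp_le_exp.2 ?_
        have := mul_le_mul_of_nonneg_right ht (by positivity : 0 ≤ 2 / n)
        have e : (1 / 4 * n * Real.log n + γ * n - 1) * (2 / n) =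
            Real.log n / 2 + 2 * γ - 2 / n := by field_simp; ring
        linarith
    _ = _ := by rw [Real.exp_add, hsq]

/-- A lower bound at time `t = n log n / 4 + γ n` for the quantity that governs
`one_sub_le_distToStationary`. The loss `exp (-4)` covers the difference between
`log (1 - 2 / n)` and `-2 / n`. -/
lemma exp_le_card_mul_one_sub_pow {n γ : ℝ} (hn : 4 ≤ n) (hγ : γ ≤ 0) {t : ℕ}
    (ht : (t : ℝ) ≤ 1 / 4 * n * Real.log n + γ * n) :
    Real.exp (-4 * γ - 4) ≤ n * (1 - 2 / n) ^ (2 * t) := by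
  have hn0 : 0 < n := by linarith
  have hn2 : 0 < n - 2 := by linarith
  have hpos : 0 < 1 - 2 / n := by rw [sub_pos, div_lt_one hn0]; linarith
  have hlog : -(2 / (n - 2)) ≤ Real.log (1 - 2 / n) := by
    refine le_trans (le_of_eq ?_) (Real.one_sub_inv_le_log_of_pos hpos)
    rw [one_sub_div hn0.ne', inv_div]
    field_simp
    ring
  calc Real.exp (-4 * γ - 4)
      ≤ Real.exp (Real.log n + (2 * t : ℕ) * -(2 / (n - 2))) := by
        refine Real.exp_le_exp.2 ?_
        have hl1 : Real.log n ≤ n - 1 := Real.log_le_sub_one_of_pos hn0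
        have hl0 : 0 ≤ Real.log n := Real.log_nonneg (by linarith)
        have h1 : (4 * t : ℝ) / (n - 2) ≤ Real.log n + 4 * γ + 4 := by
          rw [div_le_iff₀ hn2]
          nlinarith
        push_cast
        have e : (2 * t : ℝ) * -(2 / (n - 2)) = -(4 * t / (n - 2)) := by ring
        rw [e]
        linarith
    _ ≤ Real.exp (Real.log n + (2 * t : ℕ) * Real.log (1 - 2 / n)) := by
        refine Real.exp_le_exp.2 ?_
        have := mul_le_mul_of_nonneg_left hlog (Nat.cast_nonneg (α := ℝ) (2 * t))
        linarith
    _ = _ := by rw [Real.exp_add, Real.exp_log hn0, Real.exp_nat_mul, Real.exp_log hpos]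

/-- A sequence of functions with values in `[0, 1]` that are, around the time `t n`, bounded above
by `C * exp (-2 * γ)` plus a vanishing error and below by `1 - C' * exp (4 * γ)`, has a cutoff. -/
lemma hasCutoff_of_bounds {d : ℕ → ℕ → ℝ} {t w : ℕ → ℝ} {C C' : ℝ} {ε : ℕ → ℝ}
    (hw : Tendsto (fun n => w n / t n) atTop (𝓝 0))
    (hd0 : ∀ᶠ n in atTop, ∀ k, 0 ≤ d n k) (hd1 : ∀ᶠ n in atTop, ∀ k, d n k ≤ 1)
    (hε : Tendsto ε atTop (𝓝 0))
    (hupper : ∀ γ : ℝ, 0 ≤ γ → ∀ᶠ n in atTop,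
      d n ⌊t n + γ * w n⌋₊ ≤ C * Real.exp (-2 * γ) + ε n)
    (hlower : ∀ γ : ℝ, γ ≤ 0 → ∀ᶠ n in atTop,
      1 - C' * Real.exp (4 * γ) ≤ d n ⌊t n + γ * w n⌋₊) : HasCutoff d t w := by
  have hbelow : ∀ γ : ℝ, IsBoundedUnder (· ≥ ·) atTop fun n => d n ⌊t n + γ * w n⌋₊ := fun γ =>
    isBoundedUnder_of_eventually_ge (a := 0) (hd0.mono fun n h => h _)
  have habove : ∀ γ : ℝ, IsBoundedUnder (· ≤ ·) atTop fun n => d n ⌊t n + γ * w n⌋₊ := fun γ =>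
    isBoundedUnder_of_eventually_le (a := 1) (hd1.mono fun n h => h _)
  refine ⟨hw, ?_, ?_⟩
  · have hlim : Tendsto (fun γ : ℝ => 1 - C' * Real.exp (4 * γ)) atBot (𝓝 1) := by
      have : Tendsto (fun γ : ℝ => Real.exp (4 * γ)) atBot (𝓝 0) :=
        Real.tendsto_exp_atBot.comp (tendsto_id.const_mul_atBot (by norm_num))
      simpa using (this.const_mul C').const_sub 1
    refine tendsto_of_tendsto_of_tendsto_of_le_of_le' hlim tendsto_const_nhds ?_ ?_
    · filter_upwards [eventually_le_atBot 0] with γ hγ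
      exact le_liminf_of_le (habove γ).isCoboundedUnder_ge (hlower γ hγ)
    · refine Eventually.of_forall fun γ => ?_
      exact liminf_le_of_frequently_le (hd1.mono fun n h => h _).frequently (hbelow γ)
  · have hlim : Tendsto (fun γ : ℝ => C * Real.exp (-2 * γ)) atTop (𝓝 0) := by
      have : Tendsto (fun γ : ℝ => Real.exp (-2 * γ)) atTop (𝓝 0) :=
        Real.tendsto_exp_atBot.comp (tendsto_id.const_mul_atTop_of_neg (by norm_num))
      simpa using this.const_mul C
    refine tendsto_of_tendsto_of_tendsto_of_le_of_le' tendsto_const_nhds hlim ?_ ?_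
    · refine Eventually.of_forall fun γ => ?_
      exact le_limsup_of_frequently_le (hd0.mono fun n h => h _).frequently (habove γ)
    · filter_upwards [eventually_ge_atTop 0] with γ hγ
      have hB : Tendsto (fun n => C * Real.exp (-2 * γ) + ε n) atTop
          (𝓝 (C * Real.exp (-2 * γ))) := by simpa using hε.const_add (C * Real.exp (-2 * γ))
      rw [← hB.limsup_eq]
      exact limsup_le_limsup (hupper γ hγ) (hbelow γ).isCoboundedUnder_le hB.isBoundedUnder_le

lemma hasCutoff_paintEdge {p : ℝ} (h0 : 0 < p) (h1 : p < 1)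
    (π : (n : ℕ) → ColorConfig (Fin n) → ℝ)
    (hπ : ∀ n : ℕ, 2 ≤ n →
      IsStationaryDistribution (stepMatrix p (paintEdge (V := Fin n))) (π n)) :
    HasCutoff (fun n k => distToStationary (stepMatrix p (paintEdge (V := Fin n))) (π n) k)
      (fun n => 1 / 4 * (n : ℝ) * Real.log (n : ℝ)) (fun n => (n : ℝ)) := by
  have hlog : Tendsto (fun n : ℕ => Real.log (n : ℝ)) atTop atTop :=
    Real.tendsto_log_atTop.comp tendsto_natCast_atTop_atTop
  refine hasCutoff_of_bounds (C := 4 * √(1 / (p * (1 - p))) * Real.exp 1)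
    (C' := 8 * Real.exp 4 / (1 - p) ^ 2) (ε := fun n => 512 / (n : ℝ)) ?_ ?_ ?_ ?_ ?_ ?_
  · refine ((tendsto_const_nhds (x := (4 : ℝ))).div_atTop hlog).congr' ?_
    filter_upwards [eventually_ge_atTop 2] with n hn
    have hn2 : (2 : ℝ) ≤ n := by exact_mod_cast hn
    have hl : 0 < Real.log (n : ℝ) := Real.log_pos (by linarith)
    field_simp
  · exact Eventually.of_forall fun n k => distToStationary_nonneg _ _ _
  · filter_upwards [eventually_ge_atTop 2] with n hn k
    exact distToStationary_le_one
      (stepMatrix_mem_rowStochastic h0.le h1.le (by simpa using hn) _) (hπ n hn) k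
  · exact (tendsto_const_nhds (x := (512 : ℝ))).div_atTop tendsto_natCast_atTop_atTop
  · intro γ _
    filter_upwards [eventually_ge_atTop 4] with n hn
    have hn4 : (4 : ℝ) ≤ n := by exact_mod_cast hn
    have hd := distToStationary_le (hπ n (by omega)) fun z =>
      sum_abs_pow_sub_freshStartLaw_le h0 h1 (by simpa using hn) z
        ⌊1 / 4 * (n : ℝ) * Real.log n + γ * n⌋₊
    rw [Fintype.card_fin] at hd
    refine hd.trans (add_le_add_left ?_ _)
    have hT := card_mul_one_sub_pow_le (n := n) (γ := γ) (by linarith)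
      (Nat.sub_one_lt_floor (1 / 4 * (n : ℝ) * Real.log n + γ * n)).le
    refine (mul_le_mul_of_nonneg_left hT (by positivity)).trans (le_of_eq ?_)
    have hs : √(n : ℝ) ≠ 0 := (Real.sqrt_pos.2 (by linarith)).ne'
    have hq : 0 < 1 - p := by linarith
    rw [Real.sqrt_div (by positivity), show 1 - 2 * γ = 1 + -2 * γ by ring, Real.exp_add]
    field_simp
  · intro γ hγ
    filter_upwards [eventually_ge_atTop 4, hlog.eventually_ge_atTop (-4 * γ)] with n hn hl
    have hn4 : (4 : ℝ) ≤ n := by exact_mod_cast hn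
    have hq : 0 < 1 - p := by linarith
    have hd := one_sub_le_distToStationary h0 h1 (by simpa using hn) (hπ n (by omega))
      ⌊1 / 4 * (n : ℝ) * Real.log n + γ * n⌋₊
    rw [Fintype.card_fin] at hd
    refine le_trans (sub_le_sub_left ?_ _) hd
    -- Here `n` is so large that the time is nonnegative, so that the floor does not exceed it.
    have hT := exp_le_card_mul_one_sub_pow (n := n) hn4 hγ
      (Nat.floor_le (a := 1 / 4 * (n : ℝ) * Real.log n + γ * n) (by nlinarith))
    calc _ ≤ 8 / ((1 - p) ^ 2 * Real.exp (-4 * γ - 4)) := by gcongr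
      _ = _ := by
        rw [show -4 * γ - 4 = -(4 + 4 * γ) by ring, Real.exp_neg, Real.exp_add]
        field_simp

theorem theorem1 (p : ℝ) (hp0 : 0 < p) (hp1 : p < 1) :
    (∀ n : ℕ, 2 ≤ n →
      ∃! π : ColorConfig (Fin n) → ℝ,
        IsStationaryDistribution (edgeFlipping (⊤ : SimpleGraph (Fin n)) p) π) ∧
    ∀ π : (n : ℕ) → ColorConfig (Fin n) → ℝ,
      (∀ n : ℕ, 2 ≤ n →
        IsStationaryDistribution (edgeFlipping (⊤ : SimpleGraph (Fin n)) p) (π n)) →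
      HasCutoff
        (fun n k => distToStationary (edgeFlipping (⊤ : SimpleGraph (Fin n)) p) (π n) k)
        (fun n => 1 / 4 * (n : ℝ) * Real.log (n : ℝ))
        (fun n => (n : ℝ)) := by
  simp only [edgeFlipping_top_eq_stepMatrix]
  refine ⟨fun n hn => ?_, hasCutoff_paintEdge hp0 hp1⟩
  have hV : 2 ≤ Fintype.card (Fin n) := by simpa using hn
  obtain ⟨π, hπ⟩ := exists_isStationaryDistribution hp0.le hp1.le hV
  exact ⟨π, hπ, fun ρ hρ => hρ.eq hp0.le hp1.le hV hπ⟩
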